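/- **Theorem 5.18 (automorphisms and truth values).** Let $A$ be a von Neumann algebra, $h:A\to A$ a $*$-automorphism, $\psi$ a state on $A$ (a positive normalised linear functional), $a\in A$ self-adjoint and $\Delta\subseteq\mathbb R$ a Borel set with spectral projection $\chi_\Delta(a)$. Let $\mathcal C$ be the set of contexts (abelian von Neumann subalgebras) of $A$, ordered by inclusion. For every $C\in\mathcal C$ the image $h[C]$ is again a context. Let $\Sigma_C$ be the Gelfand spectrum of $C$, and let $\mu^C:\mathcal O\Sigma_C\to[0,1]$ be the probability valuation which represents the state $\psi|_C$ (Riesz–Markov). *Contravariant model.* Let $\Sigma_\downarrow=\coprod_{C}\Sigma_C$, where $U=\coprod_C U_C$ is open iff each $U_C\subseteq\Sigma_C$ is open and $\lambda\in U_C$, $D\subseteq C$ imply $\lambda|_D\in U_D$. Let $\hat h^*\Sigma_\downarrow=\coprod_C\Sigma_{h[C]}$ (over $C\in\mathcal C$) be its pullback along $\hat h:C\mapsto h[C]$, with open sets defined in the same way, and let $\Sigma(h):\hat h^*\Sigma_\downarrow\to\Sigma_\downarrow$ be the continuous map $(C,\lambda)\mapsto(C,\lambda\circ h|_C)$. In the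 topos $[\mathcal C^{op},\mathbf{Set}]$ let $\mathcal O\underline\Sigma$ and $\mathcal OH^*\underline\Sigma$ be the presheaves whose sections over $C$ are the open subsets of the parts of $\Sigma_\downarrow$ and $\hat h^*\Sigma_\downarrow$ over $\downarrow C$, and let $\underline{[0,1]}_l$ be the presheaf whose sections over $C$ are the order-reversing functions $\downarrow C\to[0,1]$. Taking preimages under $\Sigma(h)$ gives $\underline\Sigma(h)^{-1}:\mathcal O\underline\Sigma\to\mathcal OH^*\underline\Sigma$; the state gives the valuations $\underline\mu:\mathcal O\underline\Sigma\to\underline{[0,1]}_l$, $\underline\mu_C(U)(D)=\mu^D(U_D)$, and $\underline\mu_h:\mathcal OH^*\underline\Sigma\to\underline{[0,1]}_l$, $(\underline\mu_h)_C(U)(D)=\mu^{h[D]}(U_D)$. The elementary proposition $\underline{[a\in\Delta]}:\underline 1\to\mathcal O\underline\Sigma$ is given by the open set $\{(C,\lambda)\mid\lambda(\delta^o(\chi_\Delta(a))_C)=1\}$, where $\delta^o(p)_C=\bigwedge\{q\in\mathrm{Proj}(C)\mid q\ge p\}$. Let $\underline 1$ also denote the constant function $1$ in $\underline{[0,1]}_l$,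 and write $C\Vdash s=t$ if the global elements $s$ and $t$ have the same component at $C$. Then for every $C\in\mathcal C$ $$C\Vdash\underline\mu_h\bigl(\underline\Sigma(h)^{-1}(\underline{[a\in\Delta]})\bigr)=\underline 1\quad\Longleftrightarrow\quad h[C]\Vdash\underline\mu\bigl(\underline{[h(a)\in\Delta]}\bigr)=\underline 1 ,$$ and consequently, if $S$ is the sieve of all contexts which force the equation on the left, then $h[S]=\{h[C]\mid C\in S\}$ is the sieve of all contexts which force $\underline\mu(\underline{[h(a)\in\Delta]})=\underline 1$. *Covariant model.* The same two statements hold in $[\mathcal C,\mathbf{Set}]$, with cosieves instead of sieves, where now: in the definition of the open sets of $\Sigma_\uparrow=\coprod_C\Sigma_C$ and $\hat h^*\Sigma_\uparrow$ the condition on restrictions is replaced by "$\lambda\in\Sigma_C$, $D\subseteq C$ and $\lambda|_D\in U_D$ imply $\lambda\in U_C$" (for $\lambda\in\Sigma_{h[C]}$ and $\lambda|_{h[D]}$ in the case of the pullback); $\downarrow C$ is replaced by $\uparrow C$, and order-reversing by order-preserving; and $\underline{[a\in\Delta]}$ is given by $\{(C,\lambda)\mid\lambda(\delta^i(\chi_\Delta(a))_C)=1\}$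 with inner daseinisation $\delta^i(p)_C=\bigvee\{q\in\mathrm{Proj}(C)\mid q\le p\}$. -/

import Mathlib

open MeasureTheory CategoryTheory Opposite TopologicalSpace
open scoped InnerProductSpace ComplexOrder CompactlySupported

section SpectralProjection
variable {H : Type*} [NormedAddCommGroup H] [InnerProductSpace ℂ H] [CompleteSpace H]

/-- A bounded quadratic form is represented by a bounded operator. -/
theorem exists_operator_of_quadratic (q : H → ℝ) (h0 : ∀ x, 0 ≤ q x) (h1 : ∀ x, q x ≤ ‖x‖ ^ 2)
    (hadd : ∀ x y z, q (x + y + z) + q x + q y + q z = q (x + y) + q (y + z) + q (x + z))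
    (hsmul : ∀ (t : ℝ), 0 ≤ t → ∀ x y,
      q ((t : ℂ) • x + y) + t * q x + t * q y = t ^ 2 * q x + q y + t * q (x + y))
    (hI : ∀ x, q (Complex.I • x) = q x) :
    ∃ E : H →L[ℂ] H, ∀ x, ⟪x, E x⟫_ℂ = (q x : ℂ) := by
  have q0 : q 0 = 0 := le_antisymm (by simpa using h1 0) (h0 0)
  let R : H → H → ℝ := fun x y => (q (x + y) - q x - q y) / 2
  have Rsymm : ∀ x y, R x y = R y x := fun x y => by simp only [R, add_comm x y]; ring
  have Radd : ∀ x y z, R (x + y) z = R x z + R y z := fun x y z => by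
    have := hadd x y z
    simp only [R]; linarith
  have R0 : ∀ y, R 0 y = 0 := fun y => by simp [R, q0]
  have Rneg : ∀ x y, R (-x) y = - R x y := fun x y => by
    have := Radd x (-x) y
    rw [add_neg_cancel, R0] at this; linarith
  have Rpos : ∀ t : ℝ, 0 ≤ t → ∀ x y, R ((t : ℂ) • x) y = t * R x y := fun t ht x y => by
    have a1 := hsmul t ht x y
    have a2 := hsmul t ht x 0
    simp only [add_zero, q0] at a2
    simp only [R]; linarith
  have Rsm : ∀ t : ℝ, ∀ x y, R ((t : ℂ) • x) y = t * R x y := fun t x y => by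
    rcases le_total 0 t with ht | ht
    · exact Rpos t ht x y
    · have := Rpos (-t) (by linarith) x y
      rw [Complex.ofReal_neg, neg_smul, Rneg] at this; linarith
  have RI : ∀ x y, R (Complex.I • x) (Complex.I • y) = R x y := fun x y => by
    simp only [R, ← smul_add, hI]
  have II : ∀ x : H, Complex.I • Complex.I • x = -x := fun x => by
    rw [smul_smul, Complex.I_mul_I, neg_one_smul]
  have RI' : ∀ x y, R (Complex.I • x) y = - R x (Complex.I • y) := fun x y => by
    rw [← RI x (Complex.I • y), II, Rsymm _ (-y), Rneg, Rsymm y]; ring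
  have Radd' : ∀ x y z, R x (y + z) = R x y + R x z := fun x y z => by
    rw [Rsymm, Radd, Rsymm y, Rsymm z]
  have Rsm' : ∀ t : ℝ, ∀ x y, R x ((t : ℂ) • y) = t * R x y := fun t x y => by
    rw [Rsymm, Rsm, Rsymm y]
  have Rneg' : ∀ x y, R x (-y) = - R x y := fun x y => by rw [Rsymm, Rneg, Rsymm y]
  have Rself : ∀ x, R x x = q x := fun x => by
    have a1 := hsmul 1 zero_le_one x x
    have a2 := hsmul 2 zero_le_two x 0
    simp only [add_zero, q0] at a2
    have : x + x = ((2 : ℝ) : ℂ) • x := by rw [Complex.ofReal_ofNat, two_smul]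
    simp only [R, this]; linarith
  have Rbd1 : ∀ x y, ‖x‖ ≤ 1 → ‖y‖ ≤ 1 → |R x y| ≤ 3 := fun x y hx hy => by
    have b1 := h1 x
    have b2 := h1 y
    have b3 := h1 (x + y)
    have b4 : ‖x + y‖ ≤ 2 := (norm_add_le _ _).trans (by linarith)
    have c1 : ‖x‖ ^ 2 ≤ 1 := pow_le_one₀ (norm_nonneg _) hx
    have c2 : ‖y‖ ^ 2 ≤ 1 := pow_le_one₀ (norm_nonneg _) hy
    have c3 : ‖x + y‖ ^ 2 ≤ 2 ^ 2 := pow_le_pow_left₀ (norm_nonneg _) b4 2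
    have d1 := h0 x
    have d2 := h0 y
    have d3 := h0 (x + y)
    simp only [R]
    rw [abs_le]; constructor <;> linarith
  have unit : ∀ x : H, ∃ u : H, ‖u‖ ≤ 1 ∧ x = ((‖x‖ : ℝ) : ℂ) • u := fun x => by
    by_cases hx : x = 0
    · exact ⟨0, by simp, by simp [hx]⟩
    · refine ⟨((‖x‖⁻¹ : ℝ) : ℂ) • x, ?_, ?_⟩
      · rw [norm_smul]; simp [hx]
      · rw [smul_smul, ← Complex.ofReal_mul, mul_inv_cancel₀ (norm_ne_zero_iff.mpr hx)]; simp
  have Rbd : ∀ x y, |R x y| ≤ 3 * ‖x‖ * ‖y‖ := fun x y => by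
    obtain ⟨u, hu, hxu⟩ := unit x
    obtain ⟨v, hv, hyv⟩ := unit y
    have : R x y = ‖x‖ * (‖y‖ * R u v) := by
      conv_lhs => rw [hxu, hyv, Rsm, Rsm']
    rw [this, abs_mul, abs_mul, abs_norm, abs_norm]
    have := Rbd1 u v hu hv
    nlinarith [mul_nonneg (norm_nonneg x) (norm_nonneg y)]
  let B : H → H → ℂ := fun x y => (R x y : ℂ) - Complex.I * (R x (Complex.I • y) : ℂ)
  have decomp : ∀ (c : ℂ) (x : H), c • x = (c.re : ℂ) • x + (c.im : ℂ) • (Complex.I • x) :=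
    fun c x => by rw [smul_smul, ← add_smul, Complex.re_add_im]
  have Bsm' : ∀ (c : ℂ) x y, B x (c • y) = c * B x y := fun c x y => by
    have e1 : R x (c • y) = c.re * R x y + c.im * R x (Complex.I • y) := by
      rw [decomp c y, Radd', Rsm', Rsm']
    have e2 : R x (Complex.I • c • y) = c.re * R x (Complex.I • y) - c.im * R x y := by
      rw [smul_comm, decomp c (Complex.I • y), Radd', Rsm', Rsm', II, Rneg']; ring
    simp only [B, e1, e2]
    apply Complex.ext <;> simp <;> ring
  have Bsm : ∀ (c : ℂ) x y, B (c • x) y = (starRingEnd ℂ) c * B x y := fun c x y => by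
    have e1 : ∀ y, R (c • x) y = c.re * R x y - c.im * R x (Complex.I • y) := fun y => by
      rw [decomp c x, Radd, Rsm, Rsm, RI']; ring
    have e2 : R x (Complex.I • Complex.I • y) = - R x y := by rw [II, Rneg']
    simp only [B, e1, e2]
    apply Complex.ext <;> simp <;> ring
  have Bbd : ∀ x y, ‖B x y‖ ≤ 6 * ‖x‖ * ‖y‖ := fun x y => by
    refine (norm_sub_le _ _).trans ?_
    have a1 := Rbd x y
    have a2 := Rbd x (Complex.I • y)
    rw [norm_smul, Complex.norm_I, one_mul] at a2
    rw [norm_mul, Complex.norm_I, one_mul, Complex.norm_real, Complex.norm_real,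
      Real.norm_eq_abs, Real.norm_eq_abs]
    linarith
  let Bl : H →ₗ⋆[ℂ] H →ₗ[ℂ] ℂ := LinearMap.mk₂'ₛₗ (starRingEnd ℂ) (RingHom.id ℂ) B
    (fun x y z => by simp only [B, Radd]; push_cast; ring)
    (fun c x y => by simp only [Bsm, smul_eq_mul])
    (fun x y z => by simp only [B, smul_add, Radd']; push_cast; ring)
    (fun c x y => by simp only [Bsm', RingHom.id_apply, smul_eq_mul])
  let Bc : H →L⋆[ℂ] H →L[ℂ] ℂ := Bl.mkContinuous₂ 6 Bbd
  refine ⟨(InnerProductSpace.continuousLinearMapOfBilin Bc).adjoint, fun x => ?_⟩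
  rw [ContinuousLinearMap.adjoint_inner_right, InnerProductSpace.continuousLinearMapOfBilin_apply]
  change B x x = _
  have : R x (Complex.I • x) = 0 := by
    have := RI' x x
    rw [Rsymm] at this; linarith
  simp [B, Rself, this]

theorem measureReal_add_apply' {X : Type*} [MeasurableSpace X] (μ ν : Measure X)
    [IsFiniteMeasure μ] [IsFiniteMeasure ν] (s : Set X) :
    (μ + ν).real s = μ.real s + ν.real s :=
  measureReal_add_apply

/-- The positive linear functional `f ↦ ⟪x, f(a) x⟫` on `C_c(ℝ)`. -/
noncomputable def spectralFunctional (a : H →L[ℂ] H) (x : H) : C_c(ℝ, ℝ) →ₚ[ℝ] ℝ :=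
  PositiveLinearMap.mk₀
    { toFun := fun f => (⟪x, cfc (f : ℝ → ℝ) a x⟫_ℂ).re
      map_add' := fun f g => by
        have : cfc (fun t => f t + g t) a = cfc (f : ℝ → ℝ) a + cfc (g : ℝ → ℝ) a :=
          cfc_add a f g
        change (⟪x, cfc (fun t => f t + g t) a x⟫_ℂ).re = _
        rw [this]; simp
      map_smul' := fun c f => by
        have : cfc (fun t => c * f t) a = c • cfc (f : ℝ → ℝ) a :=
          cfc_const_mul c f a
        change (⟪x, cfc (fun t => c * f t) a x⟫_ℂ).re = _
        rw [this]
        have : (c • cfc (f : ℝ → ℝ) a) x = (c : ℂ) • (cfc (f : ℝ → ℝ) a x) := by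
          simp
        rw [this, inner_smul_right]; simp }
    (fun f hf => by
      have : 0 ≤ cfc (f : ℝ → ℝ) a := cfc_nonneg fun t _ => hf t
      rw [ContinuousLinearMap.nonneg_iff_isPositive] at this
      have := this.inner_nonneg_right x
      exact (Complex.le_def.mp this).1)

/-- The spectral measure `μ_x` of `a` at the vector `x`: the Riesz–Markov measure with
`∫ f ∂μ_x = ⟪x, f(a) x⟫` for all `f ∈ C_c(ℝ)`. -/
noncomputable def vectorSpectralMeasure (a : H →L[ℂ] H) (x : H) : Measure ℝ :=
  RealRMK.rieszMeasure (spectralFunctional a x)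

theorem vectorSpectralMeasure_univ_le (a : H →L[ℂ] H) (x : H) :
    vectorSpectralMeasure a x Set.univ ≤ ENNReal.ofReal (‖x‖ ^ 2) := by
  have : (vectorSpectralMeasure a x).Regular := by
    unfold vectorSpectralMeasure; infer_instance
  rw [isOpen_univ.measure_eq_iSup_isCompact]
  refine iSup_le fun K => iSup_le fun _ => iSup_le fun hK => ?_
  obtain ⟨f, hf1, hf2, -, hf3⟩ :=
    exists_continuousMap_one_of_isCompact_subset_isOpen hK isOpen_univ (Set.subset_univ K)
  let g : C_c(ℝ, ℝ) := ⟨f, hasCompactSupport_def.mpr hf2⟩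
  refine (RealRMK.rieszMeasure_le_of_eq_one (spectralFunctional a x) (f := g)
    (fun t => (hf3 t).1) hK (fun t ht => hf1 ht)).trans (ENNReal.ofReal_le_ofReal ?_)
  have hle : cfc (g : ℝ → ℝ) a ≤ 1 := cfc_le_one _ a fun t _ => (hf3 t).2
  rw [ContinuousLinearMap.le_def] at hle
  have := hle.inner_nonneg_right x
  have h2 := (Complex.le_def.mp this).1
  have h3 : (⟪x, x⟫_ℂ).re = ‖x‖ ^ 2 := inner_self_eq_norm_sq (𝕜 := ℂ) x
  simp only [sub_apply, one_apply_eq_self, inner_sub_right,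
    Complex.sub_re, Complex.zero_re, h3] at h2
  change (⟪x, cfc (g : ℝ → ℝ) a x⟫_ℂ).re ≤ _
  linarith

instance (a : H →L[ℂ] H) (x : H) : IsFiniteMeasure (vectorSpectralMeasure a x) :=
  ⟨(vectorSpectralMeasure_univ_le a x).trans_lt ENNReal.ofReal_lt_top⟩

theorem integral_vectorSpectralMeasure (a : H →L[ℂ] H) (x : H) (f : C_c(ℝ, ℝ)) :
    ∫ t, f t ∂(vectorSpectralMeasure a x) = (⟪x, cfc (f : ℝ → ℝ) a x⟫_ℂ).re :=
  RealRMK.integral_rieszMeasure (spectralFunctional a x) f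

theorem exists_spectralProjection (a : H →L[ℂ] H) (Δ : Set ℝ) :
    ∃ E : H →L[ℂ] H, ∀ x, ⟪x, E x⟫_ℂ = ((vectorSpectralMeasure a x).real Δ : ℂ) := by
  apply exists_operator_of_quadratic
  · exact fun x => measureReal_nonneg
  · intro x
    refine (measureReal_mono (Set.subset_univ _)).trans ?_
    exact ENNReal.toReal_le_of_le_ofReal (by positivity) (vectorSpectralMeasure_univ_le a x)
  · intro x y z
    have : vectorSpectralMeasure a (x + y + z) + vectorSpectralMeasure a x
        + vectorSpectralMeasure a y + vectorSpectralMeasure a z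
        = vectorSpectralMeasure a (x + y) + vectorSpectralMeasure a (y + z)
        + vectorSpectralMeasure a (x + z) := by
      refine Measure.ext_of_integral_eq_on_compactlySupported fun f => ?_
      iterate 5 rw [integral_add_measure f.integrable f.integrable]
      simp only [integral_vectorSpectralMeasure, map_add, inner_add_left, inner_add_right,
        Complex.add_re]
      ring
    have := congrArg (fun m : Measure ℝ => m.real Δ) this
    simpa only [measureReal_add_apply'] using this
  · intro t ht x y
    lift t to NNReal using ht
    have : vectorSpectralMeasure a (((t : ℝ) : ℂ) • x + y) + t • vectorSpectralMeasure a x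
        + t • vectorSpectralMeasure a y
        = t ^ 2 • vectorSpectralMeasure a x + vectorSpectralMeasure a y
        + t • vectorSpectralMeasure a (x + y) := by
      refine Measure.ext_of_integral_eq_on_compactlySupported fun f => ?_
      iterate 4 rw [integral_add_measure f.integrable f.integrable]
      simp only [integral_smul_nnreal_measure, integral_vectorSpectralMeasure, map_add, map_smul,
        inner_add_left, inner_add_right, inner_smul_left, inner_smul_right, Complex.add_re]
      simp [NNReal.smul_def]
      ring
    have := congrArg (fun m : Measure ℝ => m.real Δ) this
    simpa only [measureReal_add_apply', measureReal_nnreal_smul_apply, NNReal.coe_pow] using this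
  · intro x
    have : vectorSpectralMeasure a (Complex.I • x) = vectorSpectralMeasure a x := by
      refine Measure.ext_of_integral_eq_on_compactlySupported fun f => ?_
      simp only [integral_vectorSpectralMeasure, map_smul, inner_smul_left, inner_smul_right]
      simp
    rw [this]

/-- The spectral projection `χ_Δ(a)` of a self-adjoint operator `a`: the bounded operator with
`⟪x, χ_Δ(a) x⟫ = μ_x(Δ)` for every vector `x`, where `μ_x` is the spectral measure of `a`
at `x`. -/
noncomputable def spectralProjection (a : H →L[ℂ] H) (Δ : Set ℝ) : H →L[ℂ] H :=
  Classical.choose (exists_spectralProjection a Δ)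

theorem inner_spectralProjection (a : H →L[ℂ] H) (Δ : Set ℝ) (x : H) :
    ⟪x, spectralProjection a Δ x⟫_ℂ = ((vectorSpectralMeasure a x).real Δ : ℂ) :=
  Classical.choose_spec (exists_spectralProjection a Δ) x

end SpectralProjection

universe u

section Contexts
variable {H : Type u} [NormedAddCommGroup H] [InnerProductSpace ℂ H] [CompleteSpace H]

theorem VonNeumannAlgebra.isClosed_coe (A : VonNeumannAlgebra H) :
    IsClosed (A : Set (H →L[ℂ] H)) := by
  rw [← A.centralizer_centralizer]
  exact Set.isClosed_centralizer _

/-- A context of `A`: an abelian von Neumann subalgebra of `A`. -/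
structure Context (A : VonNeumannAlgebra H) where
  toVN : VonNeumannAlgebra H
  le : toVN ≤ A
  comm : ∀ x ∈ toVN, ∀ y ∈ toVN, x * y = y * x

namespace Context
variable {A : VonNeumannAlgebra H}

/-- Contexts are ordered by inclusion. -/
instance : PartialOrder (Context A) :=
  PartialOrder.lift Context.toVN fun C D h => by cases C; cases D; cases h; rfl

/-- The underlying `*`-algebra of a context. -/
abbrev alg (C : Context A) : StarSubalgebra ℂ (H →L[ℂ] H) := C.toVN.toStarSubalgebra

instance (C : Context A) : IsClosed (C.alg : Set (H →L[ℂ] H)) := C.toVN.isClosed_coe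

noncomputable instance (C : Context A) : CommCStarAlgebra C.alg :=
  { StarSubalgebra.cstarAlgebra C.alg with
    mul_comm := fun x y => Subtype.ext (C.comm x x.2 y y.2) }

/-- The inclusion `D ⊆ C` as a `*`-homomorphism. -/
noncomputable def incl {D C : Context A} (hDC : D ≤ C) : D.alg →⋆ₐ[ℂ] C.alg :=
  StarSubalgebra.inclusion hDC

/-- The inclusion `C ⊆ A` as a `*`-homomorphism. -/
noncomputable def inclA (C : Context A) : C.alg →⋆ₐ[ℂ] A.toStarSubalgebra :=
  StarSubalgebra.inclusion C.le

/-- The Gelfand spectrum `Σ_C` of a context, with the weak-* topology. -/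
abbrev Spec (C : Context A) : Type u := WeakDual.characterSpace ℂ C.alg

noncomputable instance (C : Context A) : MeasurableSpace C.Spec := borel _
instance (C : Context A) : BorelSpace C.Spec := ⟨rfl⟩

/-- The restriction map `ρ_{CD} : Σ_C → Σ_D`, `λ ↦ λ|_D`, for `D ⊆ C`. -/
noncomputable def restr {D C : Context A} (hDC : D ≤ C) : C(C.Spec, D.Spec) :=
  WeakDual.CharacterSpace.compContinuousMap (incl hDC)

/-- The `*`-homomorphism `C(Σ_C, ℂ) ≅ C ⊆ A` given by the inverse Gelfand transform. -/
noncomputable def ofSpec (C : Context A) : C(C.Spec, ℂ) →⋆ₐ[ℂ] A.toStarSubalgebra :=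
  C.inclA.comp ((gelfandStarTransform C.alg).symm : C(C.Spec, ℂ) →⋆ₐ[ℂ] C.alg)

end Context

/-- The projections of a von Neumann algebra, with the operator order (`p ≤ q` iff `q - p` is
positive). -/
abbrev Proj (C : VonNeumannAlgebra H) : Type u := {q : H →L[ℂ] H // q ∈ C ∧ IsStarProjection q}

theorem exists_isGLB_proj' (C : VonNeumannAlgebra H) (S : Set (Proj C)) :
    ∃ g : Proj C, IsGLB S g ∧
      ∀ r : H →L[ℂ] H, IsStarProjection r → (∀ q ∈ S, r ≤ q.1) → r ≤ g.1 := by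
  let K : Submodule ℂ H := ⨅ q ∈ S, q.1.range
  have hcl : ∀ q : Proj C, IsClosed (q.1.range : Set H) := fun q => by
    exact ContinuousLinearMap.IsIdempotentElem.isClosed_range q.2.2.isIdempotentElem
  have hK : IsClosed (K : Set H) := by
    simp only [K, Submodule.coe_iInf]
    exact isClosed_iInter fun q => isClosed_iInter fun _ => hcl q
  have : CompleteSpace K := hK.completeSpace_coe
  have hmem : K.starProjection ∈ C := by
    rw [VonNeumannAlgebra.IsStarProjection.mem_iff isStarProjection_starProjection]
    intro y hy
    rw [Submodule.range_starProjection]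
    intro x hx
    simp only [K, Submodule.mem_iInf, Submodule.mem_comap] at hx ⊢
    intro q hq
    exact (VonNeumannAlgebra.IsStarProjection.mem_iff q.2.2 C).mp q.2.1 y hy (hx q hq)
  have hglb : ∀ r : H →L[ℂ] H, IsStarProjection r → (∀ q ∈ S, r ≤ q.1) →
      r ≤ K.starProjection := by
    intro r hr hrS
    obtain ⟨_, hr'⟩ := isStarProjection_iff_eq_starProjection_range.mp hr
    rw [hr', Submodule.starProjection_le_starProjection_iff]
    refine le_iInf₂ fun q hq => ?_
    obtain ⟨_, hq'⟩ := isStarProjection_iff_eq_starProjection_range.mp q.2.2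
    have : r ≤ q.1 := hrS q hq
    rwa [hr', hq', Submodule.starProjection_le_starProjection_iff] at this
  refine ⟨⟨K.starProjection, hmem, isStarProjection_starProjection⟩, ⟨?_, ?_⟩, hglb⟩
  · intro q hq
    obtain ⟨_, hq'⟩ := isStarProjection_iff_eq_starProjection_range.mp q.2.2
    change K.starProjection ≤ q.1
    rw [hq', Submodule.starProjection_le_starProjection_iff]
    exact iInf₂_le q hq
  · exact fun r hr => hglb r.1 r.2.2 fun q hq => hr hq

theorem exists_isGLB_proj (C : VonNeumannAlgebra H) (S : Set (Proj C)) : ∃ g, IsGLB S g :=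
  (exists_isGLB_proj' C S).imp fun _ h => h.1

theorem IsGLB.le_of_proj {C : VonNeumannAlgebra H} {S : Set (Proj C)} {g : Proj C}
    (hg : IsGLB S g) {r : H →L[ℂ] H} (hr : IsStarProjection r) (h : ∀ q ∈ S, r ≤ q.1) :
    r ≤ g.1 := by
  obtain ⟨g', hg', H'⟩ := exists_isGLB_proj' C S
  rw [hg.unique hg']
  exact H' r hr h

theorem exists_isLUB_proj' (C : VonNeumannAlgebra H) (S : Set (Proj C)) :
    ∃ g : Proj C, IsLUB S g ∧
      ∀ r : H →L[ℂ] H, IsStarProjection r → (∀ q ∈ S, q.1 ≤ r) → g.1 ≤ r := by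
  let c : Proj C → Proj C := fun q => ⟨1 - q.1, sub_mem (one_mem C) q.2.1, q.2.2.one_sub⟩
  obtain ⟨g, hg, hg'⟩ := exists_isGLB_proj' C (c '' S)
  have hlub : ∀ r : H →L[ℂ] H, IsStarProjection r → (∀ q ∈ S, q.1 ≤ r) → (c g).1 ≤ r := by
    intro r hr hrS
    refine sub_le_comm.mp (hg' (1 - r) hr.one_sub ?_)
    rintro _ ⟨q, hq, rfl⟩
    exact sub_le_sub_left (hrS q hq) 1
  refine ⟨c g, ⟨fun q hq => ?_, fun r hr => hlub r.1 r.2.2 fun q hq => hr hq⟩, hlub⟩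
  have : g.1 ≤ 1 - q.1 := hg.1 ⟨q, hq, rfl⟩
  exact le_sub_comm.mp this

theorem exists_isLUB_proj (C : VonNeumannAlgebra H) (S : Set (Proj C)) : ∃ g, IsLUB S g :=
  (exists_isLUB_proj' C S).imp fun _ h => h.1

theorem IsLUB.le_of_proj {C : VonNeumannAlgebra H} {S : Set (Proj C)} {g : Proj C}
    (hg : IsLUB S g) {r : H →L[ℂ] H} (hr : IsStarProjection r) (h : ∀ q ∈ S, q.1 ≤ r) :
    g.1 ≤ r := by
  obtain ⟨g', hg', H'⟩ := exists_isLUB_proj' C S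
  rw [hg.unique hg']
  exact H' r hr h

/-- Outer daseinisation `δᵒ(p)_C = ⋀ {q ∈ Proj C | q ≥ p}`. -/
noncomputable def outerDas (C : VonNeumannAlgebra H) (p : H →L[ℂ] H) : Proj C :=
  Classical.choose (exists_isGLB_proj C {q | p ≤ q.1})

theorem isGLB_outerDas (C : VonNeumannAlgebra H) (p : H →L[ℂ] H) :
    IsGLB {q : Proj C | p ≤ q.1} (outerDas C p) :=
  Classical.choose_spec (exists_isGLB_proj C {q | p ≤ q.1})

theorem outerDas_anti {D C : VonNeumannAlgebra H} (hDC : D ≤ C) (p : H →L[ℂ] H) :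
    (outerDas C p).1 ≤ (outerDas D p).1 :=
  (isGLB_outerDas D p).le_of_proj (outerDas C p).2.2 fun q hq =>
    (isGLB_outerDas C p).1 (show p ≤ (⟨q.1, hDC q.2.1, q.2.2⟩ : Proj C).1 from hq)

/-- Inner daseinisation `δⁱ(p)_C = ⋁ {q ∈ Proj C | q ≤ p}`. -/
noncomputable def innerDas (C : VonNeumannAlgebra H) (p : H →L[ℂ] H) : Proj C :=
  Classical.choose (exists_isLUB_proj C {q | q.1 ≤ p})

theorem isLUB_innerDas (C : VonNeumannAlgebra H) (p : H →L[ℂ] H) :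
    IsLUB {q : Proj C | q.1 ≤ p} (innerDas C p) :=
  Classical.choose_spec (exists_isLUB_proj C {q | q.1 ≤ p})

theorem innerDas_mono {D C : VonNeumannAlgebra H} (hDC : D ≤ C) (p : H →L[ℂ] H) :
    (innerDas D p).1 ≤ (innerDas C p).1 :=
  (isLUB_innerDas D p).le_of_proj (innerDas C p).2.2 fun q hq =>
    (isLUB_innerDas C p).1 (show (⟨q.1, hDC q.2.1, q.2.2⟩ : Proj C).1 ≤ p from hq)

/-- A state on `A`: a positive normalised linear functional. -/
structure State (A : VonNeumannAlgebra H) where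
  toLinearMap : A.toStarSubalgebra →ₗ[ℂ] ℂ
  nonneg : ∀ a, 0 ≤ toLinearMap (star a * a)
  map_one : toLinearMap 1 = 1

namespace State
variable {A : VonNeumannAlgebra H}

/-- The positive functional on `C(Σ_C, ℝ)` which corresponds to the restriction of `ψ` to `C`
under the Gelfand isomorphism `C ≅ C(Σ_C, ℂ)`. -/
noncomputable def localFunctional (ψ : State A) (C : Context A) : C_c(C.Spec, ℝ) →ₚ[ℝ] ℝ :=
  PositiveLinearMap.mk₀
    { toFun := fun f => (ψ.toLinearMap (C.ofSpec ((f : C(C.Spec, ℝ)).realToRCLike ℂ))).re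
      map_add' := fun f g => by
        have : ((f + g : C_c(C.Spec, ℝ)) : C(C.Spec, ℝ)).realToRCLike ℂ
            = (f : C(C.Spec, ℝ)).realToRCLike ℂ + (g : C(C.Spec, ℝ)).realToRCLike ℂ := by
          ext x; simp
        rw [this]; simp only [map_add, Complex.add_re]
      map_smul' := fun c f => by
        have : ((c • f : C_c(C.Spec, ℝ)) : C(C.Spec, ℝ)).realToRCLike ℂ
            = (c : ℂ) • (f : C(C.Spec, ℝ)).realToRCLike ℂ := by
          ext x; simp
        rw [this]; simp }
    (fun f hf => by
      let g : C(C.Spec, ℝ) := ⟨fun x => Real.sqrt (f x), by fun_prop⟩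
      have : (f : C(C.Spec, ℝ)).realToRCLike ℂ
          = star (g.realToRCLike ℂ) * g.realToRCLike ℂ := by
        ext x
        have h0 : (0 : ℝ) ≤ f x := hf x
        have h1 : Real.sqrt (f x) * Real.sqrt (f x) = f x := Real.mul_self_sqrt h0
        simp only [ContinuousMap.realToRCLike_apply, ContinuousMap.mul_apply,
          ContinuousMap.star_apply]
        change ((f x : ℝ) : ℂ) = star ((Real.sqrt (f x) : ℝ) : ℂ) * ((Real.sqrt (f x) : ℝ) : ℂ)
        rw [Complex.star_def, Complex.conj_ofReal, ← Complex.ofReal_mul, h1]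
      change 0 ≤ (ψ.toLinearMap (C.ofSpec ((f : C(C.Spec, ℝ)).realToRCLike ℂ))).re
      rw [this, map_mul, map_star]
      exact (Complex.le_def.mp (ψ.nonneg _)).1)

/-- The probability measure on `Σ_C` which represents the state `ψ|_C` (Riesz–Markov). -/
noncomputable def localMeasure (ψ : State A) (C : Context A) : Measure C.Spec :=
  RealRMK.rieszMeasure (ψ.localFunctional C)

instance (ψ : State A) (C : Context A) : (ψ.localMeasure C).Regular :=
  inferInstanceAs (RealRMK.rieszMeasure (ψ.localFunctional C)).Regular

instance (ψ : State A) (C : Context A) : IsFiniteMeasure (ψ.localMeasure C) :=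
  inferInstanceAs (IsFiniteMeasure (RealRMK.rieszMeasure (ψ.localFunctional C)))

theorem localMeasure_univ (ψ : State A) (C : Context A) :
    (ψ.localMeasure C).real Set.univ = 1 := by
  let o : C_c(C.Spec, ℝ) := ⟨1, HasCompactSupport.of_compactSpace 1⟩
  have h : ∫ x, o x ∂(ψ.localMeasure C) = ψ.localFunctional C o :=
    RealRMK.integral_rieszMeasure _ o
  have h1 : ((o : C(C.Spec, ℝ)).realToRCLike ℂ) = 1 := by
    ext x
    change ((1 : ℝ) : ℂ) = 1
    exact Complex.ofReal_one
  have h2 : ψ.localFunctional C o = 1 := by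
    change (ψ.toLinearMap (C.ofSpec ((o : C(C.Spec, ℝ)).realToRCLike ℂ))).re = 1
    rw [h1, _root_.map_one, ψ.map_one, Complex.one_re]
  rw [h2] at h
  change ∫ _, (1 : ℝ) ∂(ψ.localMeasure C) = 1 at h
  simpa using h

/-- The valuation `μ^C : 𝒪Σ_C → [0,1]` of the state `ψ|_C`. -/
noncomputable def localValuation (ψ : State A) (C : Context A)
    (U : Opens C.Spec) : unitInterval :=
  ⟨(ψ.localMeasure C).real U, measureReal_nonneg,
    (measureReal_mono (Set.subset_univ _)).trans (ψ.localMeasure_univ C).le⟩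

theorem map_localMeasure (ψ : State A) {D C : Context A} (hDC : D ≤ C) :
    (ψ.localMeasure C).map (Context.restr hDC) = ψ.localMeasure D := by
  have hc : Continuous (Context.restr hDC) := (Context.restr hDC).continuous
  have : ((ψ.localMeasure C).map (Context.restr hDC)).InnerRegular :=
    Measure.InnerRegular.map_of_continuous hc
  refine Measure.ext_of_integral_eq_on_compactlySupported fun f => ?_
  change ∫ x, (f : C(D.Spec, ℝ)) x ∂_ = _
  rw [integral_map hc.aemeasurable (f : C(D.Spec, ℝ)).continuous.aestronglyMeasurable]
  let g : C_c(C.Spec, ℝ) :=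
    ⟨(f : C(D.Spec, ℝ)).comp (Context.restr hDC), HasCompactSupport.of_compactSpace _⟩
  have hC : ∫ x, g x ∂(ψ.localMeasure C) = ψ.localFunctional C g :=
    RealRMK.integral_rieszMeasure _ g
  have hD : ∫ x, f x ∂(ψ.localMeasure D) = ψ.localFunctional D f :=
    RealRMK.integral_rieszMeasure _ f
  change ∫ x, g x ∂(ψ.localMeasure C) = _
  rw [hC, hD]
  change (ψ.toLinearMap (C.ofSpec ((g : C(C.Spec, ℝ)).realToRCLike ℂ))).re
    = (ψ.toLinearMap (D.ofSpec ((f : C(D.Spec, ℝ)).realToRCLike ℂ))).re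
  have key : (gelfandStarTransform C.alg).symm ((g : C(C.Spec, ℝ)).realToRCLike ℂ)
      = Context.incl hDC ((gelfandStarTransform D.alg).symm
        ((f : C(D.Spec, ℝ)).realToRCLike ℂ)) := by
    rw [StarAlgEquiv.symm_apply_eq]
    ext x
    have := congrArg (fun F : C(D.Spec, ℂ) => F (Context.restr hDC x))
      ((gelfandStarTransform D.alg).apply_symm_apply ((f : C(D.Spec, ℝ)).realToRCLike ℂ))
    exact this.symm
  have key' : C.ofSpec ((g : C(C.Spec, ℝ)).realToRCLike ℂ)
      = D.ofSpec ((f : C(D.Spec, ℝ)).realToRCLike ℂ) := congrArg C.inclA key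
  rw [key']

theorem localMeasure_restr (ψ : State A) {D C : Context A} (hDC : D ≤ C)
    (U : Opens D.Spec) :
    (ψ.localMeasure C).real (Context.restr hDC ⁻¹' U) = (ψ.localMeasure D).real U := by
  rw [← ψ.map_localMeasure hDC, measureReal_def, measureReal_def,
    Measure.map_apply (Context.restr hDC).continuous.measurable U.isOpen.measurableSet]

end State

end Contexts

section Automorphisms
variable {H : Type u} [NormedAddCommGroup H] [InnerProductSpace ℂ H] [CompleteSpace H]
variable {A : VonNeumannAlgebra H}

namespace Context

/-- The set `h[C]`, as a set of operators on `H`. -/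
def imageSet (h : A.toStarSubalgebra ≃⋆ₐ[ℂ] A.toStarSubalgebra) (C : Context A) :
    Set (H →L[ℂ] H) :=
  Set.range fun c : C.alg => (h (C.inclA c) : H →L[ℂ] H)

theorem star_imageSet (h : A.toStarSubalgebra ≃⋆ₐ[ℂ] A.toStarSubalgebra) (C : Context A) :
    C.imageSet h ∪ star (C.imageSet h) = C.imageSet h := by
  refine Set.union_eq_self_of_subset_right ?_
  rintro x ⟨c, hc⟩
  refine ⟨star c, ?_⟩
  have : h (C.inclA (star c)) = star (h (C.inclA c)) := by rw [map_star, map_star]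
  change (h (C.inclA (star c)) : H →L[ℂ] H) = x
  rw [this]
  exact star_eq_iff_star_eq.mp hc.symm

theorem comm_imageSet (h : A.toStarSubalgebra ≃⋆ₐ[ℂ] A.toStarSubalgebra) (C : Context A) :
    ∀ x ∈ C.imageSet h, ∀ y ∈ C.imageSet h, x * y = y * x := by
  rintro _ ⟨c, rfl⟩ _ ⟨d, rfl⟩
  have : h (C.inclA c) * h (C.inclA d) = h (C.inclA d) * h (C.inclA c) := by
    rw [← map_mul, ← map_mul, ← map_mul, ← map_mul, mul_comm c d]
  exact congrArg Subtype.val this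

/-- The order-preserving map `ĥ : 𝒞_A → 𝒞_A`, `C ↦ h[C]`, of a `*`-automorphism `h`. So that it is
visibly a von Neumann algebra, the context `ĥ(C)` is presented as the bicommutant of the set `h[C]`,
the smallest von Neumann algebra that contains it. -/
noncomputable def image (h : A.toStarSubalgebra ≃⋆ₐ[ℂ] A.toStarSubalgebra) :
    Context A →o Context A where
  toFun C :=
    { toVN :=
        { toStarSubalgebra := StarSubalgebra.centralizer ℂ
            (StarSubalgebra.centralizer ℂ (C.imageSet h) : Set (H →L[ℂ] H))
          centralizer_centralizer' := by
            change Set.centralizer (Set.centralizer ((StarSubalgebra.centralizer ℂ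
              (StarSubalgebra.centralizer ℂ (C.imageSet h) : Set (H →L[ℂ] H)) :
                StarSubalgebra ℂ (H →L[ℂ] H)) : Set (H →L[ℂ] H))) =
              ((StarSubalgebra.centralizer ℂ
              (StarSubalgebra.centralizer ℂ (C.imageSet h) : Set (H →L[ℂ] H)) :
                StarSubalgebra ℂ (H →L[ℂ] H)) : Set (H →L[ℂ] H))
            rw [StarSubalgebra.coe_centralizer_centralizer,
              Set.centralizer_centralizer_centralizer] }
      le := by
        intro x hx
        change x ∈ ((StarSubalgebra.centralizer ℂ
          (StarSubalgebra.centralizer ℂ (C.imageSet h) : Set (H →L[ℂ] H)) :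
            StarSubalgebra ℂ (H →L[ℂ] H)) : Set (H →L[ℂ] H)) at hx
        rw [StarSubalgebra.coe_centralizer_centralizer, star_imageSet] at hx
        have hsub : C.imageSet h ⊆ (A : Set (H →L[ℂ] H)) := by
          rintro _ ⟨c, rfl⟩
          exact (h (C.inclA c)).2
        have := Set.centralizer_subset (Set.centralizer_subset hsub) hx
        rwa [A.centralizer_centralizer] at this
      comm := by
        intro x hx y hy
        change x ∈ ((StarSubalgebra.centralizer ℂ
          (StarSubalgebra.centralizer ℂ (C.imageSet h) : Set (H →L[ℂ] H)) :
            StarSubalgebra ℂ (H →L[ℂ] H)) : Set (H →L[ℂ] H)) at hx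
        change y ∈ ((StarSubalgebra.centralizer ℂ
          (StarSubalgebra.centralizer ℂ (C.imageSet h) : Set (H →L[ℂ] H)) :
            StarSubalgebra ℂ (H →L[ℂ] H)) : Set (H →L[ℂ] H)) at hy
        rw [StarSubalgebra.coe_centralizer_centralizer, star_imageSet] at hx hy
        exact Set.centralizer_centralizer_comm_of_comm (C.comm_imageSet h) x hx y hy }
  monotone' := by
    intro D C hDC
    refine StarSubalgebra.centralizer_le (R := ℂ) _ _ ?_
    refine StarSubalgebra.centralizer_le (R := ℂ) _ _ ?_
    rintro _ ⟨c, rfl⟩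
    exact ⟨incl hDC c, rfl⟩

theorem coe_image (h : A.toStarSubalgebra ≃⋆ₐ[ℂ] A.toStarSubalgebra) (C : Context A) :
    ((image h C).toVN : Set (H →L[ℂ] H)) = (C.imageSet h).centralizer.centralizer := by
  change ((StarSubalgebra.centralizer ℂ
    (StarSubalgebra.centralizer ℂ (C.imageSet h) : Set (H →L[ℂ] H)) :
      StarSubalgebra ℂ (H →L[ℂ] H)) : Set (H →L[ℂ] H)) = _
  rw [StarSubalgebra.coe_centralizer_centralizer, star_imageSet]

/-- The restriction `h|_C : C → h[C]`. -/
noncomputable def toImage (h : A.toStarSubalgebra ≃⋆ₐ[ℂ] A.toStarSubalgebra) (C : Context A) :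
    C.alg →⋆ₐ[ℂ] (image h C).alg :=
  StarAlgHom.codRestrict ((A.toStarSubalgebra.subtype.comp (h : _ →⋆ₐ[ℂ] _)).comp C.inclA)
    (image h C).alg fun c => by
      change (h (C.inclA c) : H →L[ℂ] H) ∈ ((image h C).toVN : Set (H →L[ℂ] H))
      rw [coe_image]
      exact Set.subset_centralizer_centralizer ⟨c, rfl⟩

/-- The Gelfand dual `Σ(h|_C) : Σ_{h[C]} → Σ_C`, `λ ↦ λ ∘ h|_C`. -/
noncomputable def specMap (h : A.toStarSubalgebra ≃⋆ₐ[ℂ] A.toStarSubalgebra) (C : Context A) :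
    C((image h C).Spec, C.Spec) :=
  WeakDual.CharacterSpace.compContinuousMap (toImage h C)

theorem specMap_restr (h : A.toStarSubalgebra ≃⋆ₐ[ℂ] A.toStarSubalgebra) {D C : Context A}
    (hDC : D ≤ C) (x : (image h C).Spec) :
    specMap h D (restr ((image h).monotone hDC) x) = restr hDC (specMap h C x) :=
  rfl

/-- The subset `{λ ∈ Σ_C | λ(q) = 1}` of the Gelfand spectrum, for a projection `q` of `C`. -/
def specSet (C : Context A) (q : Proj C.toVN) : Set C.Spec := {x | x ⟨q.1, q.2.1⟩ = 1}

theorem spec_proj_eq (C : Context A) (q : Proj C.toVN) (x : C.Spec) :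
    x ⟨q.1, q.2.1⟩ = 0 ∨ x ⟨q.1, q.2.1⟩ = 1 := by
  have h1 : (⟨q.1, q.2.1⟩ : C.alg) * ⟨q.1, q.2.1⟩ = ⟨q.1, q.2.1⟩ :=
    Subtype.ext q.2.2.isIdempotentElem
  have h2 := congrArg x h1
  rw [map_mul] at h2
  have h3 : x ⟨q.1, q.2.1⟩ * (x ⟨q.1, q.2.1⟩ - 1) = 0 := by rw [mul_sub, h2]; ring
  rcases mul_eq_zero.mp h3 with h | h
  · exact Or.inl h
  · exact Or.inr (sub_eq_zero.mp h)

theorem isOpen_specSet (C : Context A) (q : Proj C.toVN) : IsOpen (C.specSet q) := by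
  have hc : Continuous fun x : C.Spec => x ⟨q.1, q.2.1⟩ :=
    (WeakDual.eval_continuous _).comp continuous_subtype_val
  have : C.specSet q = (fun x : C.Spec => x ⟨q.1, q.2.1⟩) ⁻¹' {0}ᶜ := by
    ext x
    rcases C.spec_proj_eq q x with h | h <;> simp [specSet, h]
  rw [this]
  exact isOpen_compl_singleton.preimage hc

theorem spec_proj_mono (C : Context A) (q r : Proj C.toVN) (hqr : q ≤ r) (x : C.Spec)
    (hx : x ⟨q.1, q.2.1⟩ = 1) : x ⟨r.1, r.2.1⟩ = 1 := by
  have h0 : q.1 * r.1 = q.1 := (q.2.2.le_iff_mul_eq_left r.2.2).mp hqr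
  have h1 : (⟨q.1, q.2.1⟩ : C.alg) * ⟨r.1, r.2.1⟩ = ⟨q.1, q.2.1⟩ := Subtype.ext h0
  have h2 := congrArg x h1
  rwa [map_mul, hx, one_mul] at h2

end Context




namespace Contravariant

/-- The terminal presheaf on `𝒞_A`. -/
abbrev one (A : VonNeumannAlgebra H) : (Context A)ᵒᵖ ⥤ Type u :=
  (Functor.const (Context A)ᵒᵖ).obj PUnit.{u + 1}

/-- The total space of the bundle over `𝒞_A` with fibre `Σ_{φ(C)}` over `C`. For `φ = id` this is
`Σ_↓`, and for `φ = ĥ` it is the pullback `ĥ^*Σ_↓`. -/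
def Bundle (φ : Context A →o Context A) : Type u := Σ C : Context A, (φ C).Spec

/-- `U` is open iff it is closed under restriction of functionals to smaller contexts and each
`U_C` is open in the Gelfand spectrum. -/
instance (φ : Context A →o Context A) : TopologicalSpace (Bundle φ) where
  IsOpen U := (∀ (D C : Context A) (hDC : D ≤ C) (x : (φ C).Spec),
      (⟨C, x⟩ : Bundle φ) ∈ U → (⟨D, Context.restr (φ.monotone hDC) x⟩ : Bundle φ) ∈ U) ∧
    ∀ C : Context A, IsOpen {x : (φ C).Spec | (⟨C, x⟩ : Bundle φ) ∈ U}
  isOpen_univ := ⟨fun _ _ _ _ _ => trivial, fun _ => isOpen_univ⟩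
  isOpen_inter := fun U V hU hV =>
    ⟨fun D C hDC x hx => ⟨hU.1 D C hDC x hx.1, hV.1 D C hDC x hx.2⟩,
      fun C => (hU.2 C).inter (hV.2 C)⟩
  isOpen_sUnion := fun S hS =>
    ⟨fun D C hDC x ⟨U, hU, hx⟩ => ⟨U, hU, (hS U hU).1 D C hDC x hx⟩, fun C => by
      have : {x : (φ C).Spec | (⟨C, x⟩ : Bundle φ) ∈ ⋃₀ S}
          = ⋃ U ∈ S, {x : (φ C).Spec | (⟨C, x⟩ : Bundle φ) ∈ U} := by
        ext x
        simp only [Set.mem_iUnion, exists_prop]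
        exact Iff.rfl
      rw [this]
      exact isOpen_biUnion fun U hU => (hS U hU).2 C⟩

/-- The part of the bundle over `↓C`, with the relative topology. -/
abbrev Stage (φ : Context A →o Context A) (C : Context A) : Type u := {x : Bundle φ // x.1 ≤ C}

/-- The fibre `U_D ⊆ Σ_{φ(D)}`, for `D ≤ C`, of an open set over `↓C`. -/
def fibre {φ : Context A →o Context A} {C : Context A} (U : Opens (Stage φ C)) (D : Context A)
    (hD : D ≤ C) : Opens (φ D).Spec :=
  ⟨{x | (⟨⟨D, x⟩, hD⟩ : Stage φ C) ∈ U}, by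
    obtain ⟨V, hV, hVU⟩ := isOpen_induced_iff.mp U.isOpen
    have := hV.2 D
    have h2 : {x : (φ D).Spec | (⟨⟨D, x⟩, hD⟩ : Stage φ C) ∈ U}
        = {x : (φ D).Spec | (⟨D, x⟩ : Bundle φ) ∈ V} := by
      ext x
      change (⟨⟨D, x⟩, hD⟩ : Stage φ C) ∈ (U : Set (Stage φ C)) ↔ _
      rw [← hVU]; rfl
    rw [h2]; exact this⟩

theorem fibre_restr {φ : Context A →o Context A} {C : Context A} (U : Opens (Stage φ C))
    (D E : Context A) (hED : E ≤ D) (hD : D ≤ C) (x : (φ D).Spec) (hx : x ∈ fibre U D hD) :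
    Context.restr (φ.monotone hED) x ∈ fibre U E (hED.trans hD) := by
  obtain ⟨V, hV, hVU⟩ := isOpen_induced_iff.mp U.isOpen
  change (⟨⟨D, x⟩, hD⟩ : Stage φ C) ∈ (U : Set (Stage φ C)) at hx
  change (⟨⟨E, _⟩, hED.trans hD⟩ : Stage φ C) ∈ (U : Set (Stage φ C))
  rw [← hVU] at hx ⊢
  exact hV.1 E D hED x hx

/-- The inclusion of the part over `↓D` in the part over `↓C`, for `D ≤ C`. -/
def stageIncl (φ : Context A →o Context A) {D C : Context A} (hDC : D ≤ C) :
    C(Stage φ D, Stage φ C) :=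
  ⟨fun x => ⟨x.1, x.2.trans hDC⟩, continuous_subtype_val.subtype_mk _⟩

/-- The internal topology as a presheaf: its sections over `C` are the open sets over `↓C`. For
`φ = id` this is `𝒪Σ`, and for `φ = ĥ` it is `𝒪H^*Σ`. -/
def opens (φ : Context A →o Context A) : (Context A)ᵒᵖ ⥤ Type u where
  obj C := Opens (Stage φ C.unop)
  map f := TypeCat.ofHom fun U => Opens.comap (stageIncl φ (leOfHom f.unop)) U
  map_id _ := rfl
  map_comp _ _ := rfl

/-- The open set of the total space `U` as a global element `1 ⟶ 𝒪` of the internal topology. -/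
def globalOpen {φ : Context A →o Context A} (U : Opens (Bundle φ)) : one A ⟶ opens φ where
  app C := TypeCat.ofHom fun _ =>
    (Opens.comap ⟨Subtype.val, continuous_subtype_val⟩ U : Opens (Stage φ C.unop))
  naturality _ _ _ := rfl

/-- The presheaf `[0,1]_l` of lower reals between `0` and `1`: its sections over `C` are the
order-reversing functions `↓C → [0,1]`. -/
def lowerUnit (A : VonNeumannAlgebra H) : (Context A)ᵒᵖ ⥤ Type u where
  obj C := {s : Set.Iic C.unop → unitInterval // Antitone s}
  map f := TypeCat.ofHom fun s =>
    ⟨fun D => s.1 ⟨D.1, D.2.trans (leOfHom f.unop)⟩, fun _ _ hDE => s.2 hDE⟩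
  map_id _ := rfl
  map_comp _ _ := rfl

/-- The constant lower real `1`. -/
def lowerOne (A : VonNeumannAlgebra H) : one A ⟶ lowerUnit A where
  app C := TypeCat.ofHom fun _ =>
    (⟨fun _ => 1, fun _ _ _ => le_rfl⟩ : {s : Set.Iic C.unop → unitInterval // Antitone s})
  naturality _ _ _ := rfl

/-- The internal valuation of a state: `U ↦ (D ↦ μ^{φ(D)}(U_D))`. For `φ = id` this is the
valuation `μ : 𝒪Σ ⟶ [0,1]_l`, and for `φ = ĥ` it is `μ_h : 𝒪H^*Σ ⟶ [0,1]_l`. -/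
noncomputable def valuation (ψ : State A) (φ : Context A →o Context A) :
    opens φ ⟶ lowerUnit A where
  app C := TypeCat.ofHom fun U : Opens (Stage φ C.unop) =>
    (⟨fun D => ψ.localValuation (φ D.1) (fibre U D.1 D.2), fun E D hED => by
      change (ψ.localMeasure (φ D.1)).real _ ≤ (ψ.localMeasure (φ E.1)).real _
      rw [← ψ.localMeasure_restr (φ.monotone hED)]
      exact measureReal_mono fun x hx => fibre_restr U D.1 E.1 hED D.2 x hx⟩ :
      {s : Set.Iic C.unop → unitInterval // Antitone s})
  naturality _ _ _ := rfl

/-- The continuous map `Σ(h) : ĥ^*Σ_↓ → Σ_↓`, `(C, λ) ↦ (C, λ ∘ h|_C)`. -/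
noncomputable def specMap (h : A.toStarSubalgebra ≃⋆ₐ[ℂ] A.toStarSubalgebra) :
    C(Bundle (Context.image h), Bundle (OrderHom.id : Context A →o Context A)) where
  toFun x := ⟨x.1, Context.specMap h x.1 x.2⟩
  continuous_toFun := ⟨fun _ hU =>
    ⟨fun D C hDC x hx => hU.1 D C hDC (Context.specMap h C x) hx,
      fun C => (hU.2 C).preimage (Context.specMap h C).continuous⟩⟩

/-- The restriction of `Σ(h)` to the parts over `↓C`. -/
noncomputable def stageSpecMap (h : A.toStarSubalgebra ≃⋆ₐ[ℂ] A.toStarSubalgebra)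
    (C : Context A) :
    C(Stage (Context.image h) C, Stage (OrderHom.id : Context A →o Context A) C) :=
  ⟨fun x => ⟨specMap h x.1, x.2⟩,
    ((specMap h).continuous.comp continuous_subtype_val).subtype_mk _⟩

/-- The internal inverse image map `Σ(h)⁻¹ : 𝒪Σ ⟶ 𝒪H^*Σ`. -/
noncomputable def invImage (h : A.toStarSubalgebra ≃⋆ₐ[ℂ] A.toStarSubalgebra) :
    opens (OrderHom.id : Context A →o Context A) ⟶ opens (Context.image h) where
  app C := TypeCat.ofHom fun U => Opens.comap (stageSpecMap h C.unop) U
  naturality _ _ _ := rfl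

/-- The elementary proposition
`[a ∈ Δ] = {(C, λ) | λ(δᵒ(χ_Δ(a))_C) = 1}` as an open subset of `Σ_↓`. -/
noncomputable def elementaryOpen (a : A.toStarSubalgebra) (Δ : Set ℝ) :
    Opens (Bundle (OrderHom.id : Context A →o Context A)) :=
  ⟨{x | x.2 ∈ x.1.specSet (outerDas x.1.toVN (spectralProjection (a : H →L[ℂ] H) Δ))}, by
    let p := spectralProjection (a : H →L[ℂ] H) Δ
    refine ⟨fun D C hDC x hx => ?_, fun C => C.isOpen_specSet (outerDas C.toVN p)⟩
    exact C.spec_proj_mono (outerDas C.toVN p)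
      ⟨(outerDas D.toVN p).1, hDC (outerDas D.toVN p).2.1, (outerDas D.toVN p).2.2⟩
      (outerDas_anti hDC p) x hx⟩

/-- The elementary proposition `[a ∈ Δ] : 1 ⟶ 𝒪Σ`. -/
noncomputable def elementary (a : A.toStarSubalgebra) (Δ : Set ℝ) :
    one A ⟶ opens (OrderHom.id : Context A →o Context A) :=
  globalOpen (elementaryOpen a Δ)

/-- Presheaf semantics of an equality of closed terms: `C ⊩ s = t`. -/
def Forces {X : (Context A)ᵒᵖ ⥤ Type u} (C : Context A) (s t : one A ⟶ X) : Prop :=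
  s.app (op C) PUnit.unit = t.app (op C) PUnit.unit

/-- The truth value of `s = t`: the sieve on `𝒞_A` of the contexts that force it. -/
def truthValue {X : (Context A)ᵒᵖ ⥤ Type u} (s t : one A ⟶ X) : LowerSet (Context A) where
  carrier := {C | Forces C s t}
  lower' := by
    intro C D hDC hC
    have hs := ConcreteCategory.congr_hom (s.naturality (homOfLE hDC).op) PUnit.unit
    have ht := ConcreteCategory.congr_hom (t.naturality (homOfLE hDC).op) PUnit.unit
    have : X.map (homOfLE hDC).op (s.app (op C) PUnit.unit)
        = X.map (homOfLE hDC).op (t.app (op C) PUnit.unit) := congrArg _ hC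
    exact hs.trans (this.trans ht.symm)

end Contravariant

namespace Covariant

/-- The terminal copresheaf on `𝒞_A`. -/
abbrev one (A : VonNeumannAlgebra H) : Context A ⥤ Type u :=
  (Functor.const (Context A)).obj PUnit.{u + 1}

/-- The total space of the bundle over `𝒞_A` with fibre `Σ_{φ(C)}` over `C`. For `φ = id` this is
`Σ_↑`, and for `φ = ĥ` it is the pullback `ĥ^*Σ_↑`. -/
def Bundle (φ : Context A →o Context A) : Type u := Σ C : Context A, (φ C).Spec

/-- `U` is open iff it is closed under extension of functionals to larger contexts and each
`U_C` is open in the Gelfand spectrum. -/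
instance (φ : Context A →o Context A) : TopologicalSpace (Bundle φ) where
  IsOpen U := (∀ (D C : Context A) (hDC : D ≤ C) (x : (φ C).Spec),
      (⟨D, Context.restr (φ.monotone hDC) x⟩ : Bundle φ) ∈ U → (⟨C, x⟩ : Bundle φ) ∈ U) ∧
    ∀ C : Context A, IsOpen {x : (φ C).Spec | (⟨C, x⟩ : Bundle φ) ∈ U}
  isOpen_univ := ⟨fun _ _ _ _ _ => trivial, fun _ => isOpen_univ⟩
  isOpen_inter := fun U V hU hV =>
    ⟨fun D C hDC x hx => ⟨hU.1 D C hDC x hx.1, hV.1 D C hDC x hx.2⟩,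
      fun C => (hU.2 C).inter (hV.2 C)⟩
  isOpen_sUnion := fun S hS =>
    ⟨fun D C hDC x ⟨U, hU, hx⟩ => ⟨U, hU, (hS U hU).1 D C hDC x hx⟩, fun C => by
      have : {x : (φ C).Spec | (⟨C, x⟩ : Bundle φ) ∈ ⋃₀ S}
          = ⋃ U ∈ S, {x : (φ C).Spec | (⟨C, x⟩ : Bundle φ) ∈ U} := by
        ext x
        simp only [Set.mem_iUnion, exists_prop]
        exact Iff.rfl
      rw [this]
      exact isOpen_biUnion fun U hU => (hS U hU).2 C⟩

/-- The part of the bundle over `↑C`, with the relative topology. -/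
abbrev Stage (φ : Context A →o Context A) (C : Context A) : Type u := {x : Bundle φ // C ≤ x.1}

/-- The fibre `U_D ⊆ Σ_{φ(D)}`, for `C ≤ D`, of an open set over `↑C`. -/
def fibre {φ : Context A →o Context A} {C : Context A} (U : Opens (Stage φ C)) (D : Context A)
    (hD : C ≤ D) : Opens (φ D).Spec :=
  ⟨{x | (⟨⟨D, x⟩, hD⟩ : Stage φ C) ∈ U}, by
    obtain ⟨V, hV, hVU⟩ := isOpen_induced_iff.mp U.isOpen
    have := hV.2 D
    have h2 : {x : (φ D).Spec | (⟨⟨D, x⟩, hD⟩ : Stage φ C) ∈ U}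
        = {x : (φ D).Spec | (⟨D, x⟩ : Bundle φ) ∈ V} := by
      ext x
      change (⟨⟨D, x⟩, hD⟩ : Stage φ C) ∈ (U : Set (Stage φ C)) ↔ _
      rw [← hVU]; rfl
    rw [h2]; exact this⟩

theorem fibre_restr {φ : Context A →o Context A} {C : Context A} (U : Opens (Stage φ C))
    (D E : Context A) (hDE : D ≤ E) (hD : C ≤ D) (x : (φ E).Spec)
    (hx : Context.restr (φ.monotone hDE) x ∈ fibre U D hD) : x ∈ fibre U E (hD.trans hDE) := by
  obtain ⟨V, hV, hVU⟩ := isOpen_induced_iff.mp U.isOpen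
  change (⟨⟨D, _⟩, hD⟩ : Stage φ C) ∈ (U : Set (Stage φ C)) at hx
  change (⟨⟨E, x⟩, hD.trans hDE⟩ : Stage φ C) ∈ (U : Set (Stage φ C))
  rw [← hVU] at hx ⊢
  exact hV.1 D E hDE x hx

/-- The inclusion of the part over `↑D` in the part over `↑C`, for `C ≤ D`. -/
def stageIncl (φ : Context A →o Context A) {C D : Context A} (hCD : C ≤ D) :
    C(Stage φ D, Stage φ C) :=
  ⟨fun x => ⟨x.1, hCD.trans x.2⟩, continuous_subtype_val.subtype_mk _⟩

/-- The frame of the internal locale as a copresheaf: its sections over `C` are the open sets over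
`↑C`. For `φ = id` this is `𝒪Σ`, and for `φ = ĥ` it is `𝒪H^♯Σ`. -/
def opens (φ : Context A →o Context A) : Context A ⥤ Type u where
  obj C := Opens (Stage φ C)
  map f := TypeCat.ofHom fun U => Opens.comap (stageIncl φ (leOfHom f)) U
  map_id _ := rfl
  map_comp _ _ := rfl

/-- The open set of the total space `U` as a global element `1 ⟶ 𝒪` of the internal frame. -/
def globalOpen {φ : Context A →o Context A} (U : Opens (Bundle φ)) : one A ⟶ opens φ where
  app C := TypeCat.ofHom fun _ =>
    (Opens.comap ⟨Subtype.val, continuous_subtype_val⟩ U : Opens (Stage φ C))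
  naturality _ _ _ := rfl

/-- The copresheaf `[0,1]_l` of lower reals between `0` and `1`: its sections over `C` are the
order-preserving functions `↑C → [0,1]`. -/
def lowerUnit (A : VonNeumannAlgebra H) : Context A ⥤ Type u where
  obj C := {s : Set.Ici C → unitInterval // Monotone s}
  map f := TypeCat.ofHom fun s =>
    ⟨fun D => s.1 ⟨D.1, (leOfHom f).trans D.2⟩, fun _ _ hDE => s.2 hDE⟩
  map_id _ := rfl
  map_comp _ _ := rfl

/-- The constant lower real `1`. -/
def lowerOne (A : VonNeumannAlgebra H) : one A ⟶ lowerUnit A where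
  app C := TypeCat.ofHom fun _ =>
    (⟨fun _ => 1, fun _ _ _ => le_rfl⟩ : {s : Set.Ici C → unitInterval // Monotone s})
  naturality _ _ _ := rfl

/-- The internal valuation of a state: `U ↦ (D ↦ μ^{φ(D)}(U_D))`. For `φ = id` this is the
valuation `μ : 𝒪Σ ⟶ [0,1]_l`, and for `φ = ĥ` it is `μ_h : 𝒪H^♯Σ ⟶ [0,1]_l`. -/
noncomputable def valuation (ψ : State A) (φ : Context A →o Context A) :
    opens φ ⟶ lowerUnit A where
  app C := TypeCat.ofHom fun U : Opens (Stage φ C) =>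
    (⟨fun D => ψ.localValuation (φ D.1) (fibre U D.1 D.2), fun D E hDE => by
      change (ψ.localMeasure (φ D.1)).real _ ≤ (ψ.localMeasure (φ E.1)).real _
      rw [← ψ.localMeasure_restr (φ.monotone hDE)]
      exact measureReal_mono fun x hx => fibre_restr U D.1 E.1 hDE D.2 x hx⟩ :
      {s : Set.Ici C → unitInterval // Monotone s})
  naturality _ _ _ := rfl

/-- The continuous map `Σ(h) : ĥ^*Σ_↑ → Σ_↑`, `(C, λ) ↦ (C, λ ∘ h|_C)`. -/
noncomputable def specMap (h : A.toStarSubalgebra ≃⋆ₐ[ℂ] A.toStarSubalgebra) :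
    C(Bundle (Context.image h), Bundle (OrderHom.id : Context A →o Context A)) where
  toFun x := ⟨x.1, Context.specMap h x.1 x.2⟩
  continuous_toFun := ⟨fun _ hU =>
    ⟨fun D C hDC x hx => hU.1 D C hDC (Context.specMap h C x) hx,
      fun C => (hU.2 C).preimage (Context.specMap h C).continuous⟩⟩

/-- The restriction of `Σ(h)` to the parts over `↑C`. -/
noncomputable def stageSpecMap (h : A.toStarSubalgebra ≃⋆ₐ[ℂ] A.toStarSubalgebra)
    (C : Context A) :
    C(Stage (Context.image h) C, Stage (OrderHom.id : Context A →o Context A) C) :=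
  ⟨fun x => ⟨specMap h x.1, x.2⟩,
    ((specMap h).continuous.comp continuous_subtype_val).subtype_mk _⟩

/-- The internal frame homomorphism `Σ(h)⁻¹ : 𝒪Σ ⟶ 𝒪H^♯Σ`. -/
noncomputable def invImage (h : A.toStarSubalgebra ≃⋆ₐ[ℂ] A.toStarSubalgebra) :
    opens (OrderHom.id : Context A →o Context A) ⟶ opens (Context.image h) where
  app C := TypeCat.ofHom fun U => Opens.comap (stageSpecMap h C) U
  naturality _ _ _ := rfl

/-- The elementary proposition
`[a ∈ Δ] = {(C, λ) | λ(δⁱ(χ_Δ(a))_C) = 1}` as an open subset of `Σ_↑`. -/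
noncomputable def elementaryOpen (a : A.toStarSubalgebra) (Δ : Set ℝ) :
    Opens (Bundle (OrderHom.id : Context A →o Context A)) :=
  ⟨{x | x.2 ∈ x.1.specSet (innerDas x.1.toVN (spectralProjection (a : H →L[ℂ] H) Δ))}, by
    let p := spectralProjection (a : H →L[ℂ] H) Δ
    refine ⟨fun D C hDC x hx => ?_, fun C => C.isOpen_specSet (innerDas C.toVN p)⟩
    exact C.spec_proj_mono
      ⟨(innerDas D.toVN p).1, hDC (innerDas D.toVN p).2.1, (innerDas D.toVN p).2.2⟩
      (innerDas C.toVN p) (innerDas_mono hDC p) x hx⟩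

/-- The elementary proposition `[a ∈ Δ] : 1 ⟶ 𝒪Σ`. -/
noncomputable def elementary (a : A.toStarSubalgebra) (Δ : Set ℝ) :
    one A ⟶ opens (OrderHom.id : Context A →o Context A) :=
  globalOpen (elementaryOpen a Δ)

/-- Semantics of an equality of closed terms in the copresheaf topos: `C ⊩ s = t`. -/
def Forces {X : Context A ⥤ Type u} (C : Context A) (s t : one A ⟶ X) : Prop :=
  s.app C PUnit.unit = t.app C PUnit.unit

/-- The truth value of `s = t`: the cosieve on `𝒞_A` of the contexts that force it. -/
def truthValue {X : Context A ⥤ Type u} (s t : one A ⟶ X) : UpperSet (Context A) where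
  carrier := {C | Forces C s t}
  upper' := by
    intro C D hCD hC
    have hs := ConcreteCategory.congr_hom (s.naturality (homOfLE hCD)) PUnit.unit
    have ht := ConcreteCategory.congr_hom (t.naturality (homOfLE hCD)) PUnit.unit
    have : X.map (homOfLE hCD) (s.app C PUnit.unit)
        = X.map (homOfLE hCD) (t.app C PUnit.unit) := congrArg _ hC
    exact hs.trans (this.trans ht.symm)

end Covariant

end Automorphisms

/-! Pulling back `{λ | λ(q) = 1}` along `λ ↦ λ ∘ h|_D` gives `{λ | λ(h(q)) = 1}`. The left-hand side
therefore says that for every `D ≤ C` the measure `μ^{h[D]}` gives mass 1 to the set on which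
`h(δ(χ_Δ(a))_D)` takes the value 1; the right-hand side says this of `δ(χ_Δ(h(a)))_E` for every `E ≤
h[C]` (with `≥` in the covariant model). The two agree because `C ↦ h[C]` is an order automorphism
of the contexts (`Context.image_image_symm`), `h` commutes with daseinisation
(`Context.map_outerDas`, `Context.map_innerDas`), and `h(χ_Δ(a)) = χ_Δ(h(a))`
(`exists_proj_spectralProjection`). The measures enter only through these sets.

Continuity of `h` in a weak topology is never invoked. Two facts replace it: `h` is isometric, and
it is an order automorphism of the projection lattice of `A` (`Proj.mapIso`), so that it preserves
arbitrary infima and suprema of projections.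

The hard point is that `h[C]` equals its bicommutant (`Context.coe_image_eq_imageSet`). The
projections of `h[C]` form a complete Boolean algebra whose infima are those of all projections on
`H`, and positive elements `b* b` of `h[C]` are norm limits of positive combinations of them. Such
an algebra `B` contains each projection `p` of `B''` (`projection_mem_of_bicommutant`): if `p x =
x`, `p y = 0` and every projection of `B` that fixes `x` fixes `y`, then `y = 0`. To see this,
compare the vector measures `r ↦ ‖r x‖²` and `r ↦ ‖r y‖²` by Hahn decompositions; where the second
is dominated by a multiple of the first, approximating `x = p (x + y)` by vectors `b (x + y)` with
`b ∈ B` forces `y` to vanish. A von Neumann algebra is the norm-closed span of its projections, so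
`B'' = B` if `B` is norm closed.

For spectral projections, `χ_Δ(a)` of an open interval is the support projection of `f(a)` for a
bump function `f`, and automorphisms preserve continuous functional calculus and supports.
Complements and countable unions, the latter as suprema of projections, give all Borel sets. -/

section Projections
variable {H : Type u} [NormedAddCommGroup H] [InnerProductSpace ℂ H] [CompleteSpace H]

/-! ### Projections, their fixed vectors and kernels, and supports -/

theorem IsStarProjection.apply_apply {p : H →L[ℂ] H} (hp : IsStarProjection p) (x : H) :
    p (p x) = p x :=
  congrArg (fun T : H →L[ℂ] H => T x) hp.isIdempotentElem

theorem IsStarProjection.inner_apply_left {p : H →L[ℂ] H} (hp : IsStarProjection p) (x y : H) :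
    ⟪p x, y⟫_ℂ = ⟪x, p y⟫_ℂ := by
  have := hp.isSelfAdjoint
  rw [← ContinuousLinearMap.adjoint_inner_right, ← ContinuousLinearMap.star_eq_adjoint,
    this.star_eq]

theorem IsStarProjection.inner_apply_self {p : H →L[ℂ] H} (hp : IsStarProjection p) (x : H) :
    ⟪x, p x⟫_ℂ = ((‖p x‖ ^ 2 : ℝ) : ℂ) := by
  rw [← hp.apply_apply x, ← hp.inner_apply_left, hp.apply_apply x, inner_self_eq_norm_sq_to_K]
  simp

theorem IsStarProjection.norm_apply_le {p : H →L[ℂ] H} (hp : IsStarProjection p) (x : H) :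
    ‖p x‖ ≤ ‖x‖ := by
  have h := p.le_opNorm x
  have h1 : ‖p‖ ≤ 1 := hp.norm_le
  nlinarith [norm_nonneg x]

theorem IsStarProjection.eq_of_fixed {p q : H →L[ℂ] H} (hp : IsStarProjection p)
    (hq : IsStarProjection q) (h : ∀ x, p x = x ↔ q x = x) : p = q := by
  have h1 : q * p = p := by ext x; exact (h _).mp (hp.apply_apply x)
  have h2 : p * q = q := by ext x; exact (h _).mpr (hq.apply_apply x)
  have h3 := congrArg star h1
  rw [star_mul, hp.isSelfAdjoint.star_eq, hq.isSelfAdjoint.star_eq] at h3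
  exact h3.symm.trans h2

/-- The support projection of a self-adjoint element of a von Neumann algebra. -/
theorem VonNeumannAlgebra.exists_support (M : VonNeumannAlgebra H) {b : H →L[ℂ] H} (hb : b ∈ M) :
    ∃ e ∈ M, IsStarProjection e ∧ ∀ x, e x = 0 ↔ b x = 0 := by
  let K : Submodule ℂ H := b.ker
  have hK : IsClosed (K : Set H) := b.isClosed_ker
  have : CompleteSpace K := hK.completeSpace_coe
  have hmem : K.starProjection ∈ M := by
    rw [VonNeumannAlgebra.IsStarProjection.mem_iff isStarProjection_starProjection]
    intro y hy
    rw [Submodule.range_starProjection]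
    intro x hx
    have hbx : b x = 0 := hx
    have : b * y = y * b := VonNeumannAlgebra.mem_commutant_iff.mp hy b hb
    have := congrArg (fun T : H →L[ℂ] H => T x) this
    change b (y x) = y (b x) at this
    change b (y x) = 0
    rw [this, hbx, map_zero]
  refine ⟨1 - K.starProjection, sub_mem (one_mem M) hmem, isStarProjection_starProjection.one_sub,
    fun x => ?_⟩
  change x - K.starProjection x = 0 ↔ _
  rw [sub_eq_zero, eq_comm, Submodule.starProjection_eq_self_iff]
  exact Iff.rfl

theorem mul_eq_self_of_ker {e b : H →L[ℂ] H} (he : IsStarProjection e)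
    (h : ∀ x, e x = 0 → b x = 0) : b * e = b := by
  ext x
  have : e (x - e x) = 0 := by rw [map_sub, he.apply_apply, sub_self]
  have := h _ this
  rw [map_sub, sub_eq_zero] at this
  exact this.symm

/-! ### Norm approximation of positive operators by projections -/

/-- The cone generated by the projections in a set of operators. -/
noncomputable def projCone (B : Set (H →L[ℂ] H)) : Submodule NNReal (H →L[ℂ] H) :=
  Submodule.span NNReal {q | q ∈ B ∧ IsStarProjection q}

/-- The projection `e` is the first binary digit of `a`: it is the support of `c = (2a - 1)₊`. With
`d = (2a - 1)₋`, which is orthogonal to `e`, the remainder is `2a - e = (1 - e - d) + c`, and both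
bounds follow from `c ≤ e` and `d ≤ 1 - e`. -/
theorem VonNeumannAlgebra.exists_half_split (M : VonNeumannAlgebra H) {a : H →L[ℂ] H} (ha : a ∈ M)
    (h0 : 0 ≤ a) (h1 : a ≤ 1) :
    ∃ e ∈ M, IsStarProjection e ∧ 0 ≤ 2 • a - e ∧ 2 • a - e ≤ 1 := by
  let f : ℝ → ℝ := fun t => max (2 * t - 1) 0
  let g : ℝ → ℝ := fun t => max (1 - 2 * t) 0
  have hf : Continuous f := by fun_prop
  have hg : Continuous g := by fun_prop
  have hsa : IsSelfAdjoint a := IsSelfAdjoint.of_nonneg h0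
  have hfM : cfc f a ∈ M := by
    have : IsClosed (M.toStarSubalgebra : Set (H →L[ℂ] H)) := M.isClosed_coe
    have hfa : cfc f a ∈ M.toStarSubalgebra := cfc_mem (𝕜' := ℂ) f ha
    exact hfa
  have hc0 : 0 ≤ cfc f a := cfc_nonneg fun t _ => le_max_right _ _
  have hd0 : 0 ≤ cfc g a := cfc_nonneg fun t _ => le_max_right _ _
  have hcd : cfc f a * cfc g a = 0 := by
    rw [← cfc_mul f g a hf.continuousOn hg.continuousOn]
    have : (fun t => f t * g t) = fun _ => (0 : ℝ) := by
      ext t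
      simp only [f, g]
      rcases le_total (2 * t) 1 with h | h
      · rw [max_eq_right (by linarith : 2 * t - 1 ≤ 0), zero_mul]
      · rw [max_eq_right (by linarith : 1 - 2 * t ≤ 0), mul_zero]
    rw [this, cfc_const_zero]
  have hsub : 2 • a - 1 = cfc f a - cfc g a := by
    rw [← cfc_sub f g a hf.continuousOn hg.continuousOn]
    have : (fun t => f t - g t) = fun t => 2 * t - 1 := by
      ext t
      simp only [f, g]
      rcases le_total (2 * t) 1 with h | h
      · rw [max_eq_right (by linarith : 2 * t - 1 ≤ 0), max_eq_left (by linarith)]; ring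
      · rw [max_eq_right (by linarith : 1 - 2 * t ≤ 0), max_eq_left (by linarith)]; ring
    rw [this, cfc_sub (fun t => 2 * t) (fun _ => 1) a, cfc_const_mul 2 (fun t => t) a, cfc_id' ℝ a,
      cfc_const_one ℝ a]
    congr 1
    rw [two_smul, two_smul]
  set c := cfc f a
  set d := cfc g a
  obtain ⟨e, heM, he, hker⟩ := M.exists_support hfM
  have hce : c * e = c := mul_eq_self_of_ker he fun x => (hker x).mp
  have hec : e * c = c := by
    have := congrArg star hce
    rwa [star_mul, he.isSelfAdjoint.star_eq, (IsSelfAdjoint.of_nonneg hc0).star_eq] at this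
  have hed : e * d = 0 := by
    ext x
    exact (hker (d x)).mpr (congrArg (fun T : H →L[ℂ] H => T x) hcd)
  have hde : d * e = 0 := by
    have := congrArg star hed
    rwa [star_mul, he.isSelfAdjoint.star_eq, (IsSelfAdjoint.of_nonneg hd0).star_eq,
      star_zero] at this
  have hsplit : 2 • a - e = (1 - e) + c - d := by
    rw [add_sub_assoc, ← hsub]; abel
  -- Compressing `1 - (2a - 1) ≥ 0` by `e` removes `d` and leaves `e - c`; compressing `1 + (2a - 1)
  -- ≥ 0` by `1 - e` removes `c` and leaves `1 - e - d`.
  have hc : c ≤ e := by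
    have h2 : 0 ≤ 1 - (2 • a - 1) := by
      have : 1 - (2 • a - 1) = (1 - a) + (1 - a) := by rw [two_smul]; abel
      rw [this]; exact add_nonneg (sub_nonneg.mpr h1) (sub_nonneg.mpr h1)
    have := star_left_conjugate_nonneg h2 e
    rw [hsub, he.isSelfAdjoint.star_eq] at this
    have h3 : e * (1 - (c - d)) * e = e - c := by
      simp only [mul_sub, sub_mul, mul_one, hec, hce, hed, he.isIdempotentElem.eq]
      simp
    rw [h3] at this
    exact sub_nonneg.mp this
  have hd : d ≤ 1 - e := by
    have h2 : 0 ≤ 1 + (2 • a - 1) := by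
      have : 1 + (2 • a - 1) = a + a := by rw [two_smul]; abel
      rw [this]; exact add_nonneg h0 h0
    have := star_left_conjugate_nonneg h2 (1 - e)
    rw [hsub, he.one_sub.isSelfAdjoint.star_eq] at this
    have h3 : (1 - e) * (1 + (c - d)) * (1 - e) = (1 - e) - d := by
      simp only [mul_sub, sub_mul, mul_add, add_mul, mul_one, one_mul, hec, hce, hed, hde,
        he.isIdempotentElem.eq, sub_zero]
      abel
    rw [h3] at this
    exact sub_nonneg.mp this
  refine ⟨e, heM, he, ?_, ?_⟩
  · rw [hsplit, add_sub_right_comm]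
    exact add_nonneg (sub_nonneg.mpr hd) hc0
  · have : 1 - (2 • a - e) = (e - c) + d := by rw [hsplit]; abel
    rw [← sub_nonneg, this]
    exact add_nonneg (sub_nonneg.mpr hc) hd0

/-- Splitting off one binary digit at a time produces a partial sum `∑ 2⁻ʲ eⱼ`. If `v` approximates
the remainder `2a - e`, then `(e + v) / 2` approximates `a` with half the error. -/
theorem VonNeumannAlgebra.exists_projCone_near (M : VonNeumannAlgebra H) (k : ℕ) :
    ∀ a ∈ M, 0 ≤ a → a ≤ 1 →
      ∃ v ∈ projCone (M : Set (H →L[ℂ] H)), ‖a - v‖ ≤ (1 / 2 : ℝ) ^ k := by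
  induction k with
  | zero =>
    intro a _ h0 h1
    refine ⟨0, zero_mem _, ?_⟩
    rw [sub_zero, pow_zero]
    exact CStarAlgebra.norm_le_one_iff_of_nonneg a |>.mpr h1
  | succ k ih =>
    intro a ha h0 h1
    obtain ⟨e, heM, he, h2, h3⟩ := M.exists_half_split ha h0 h1
    obtain ⟨v, hv, hav⟩ := ih (2 • a - e) (sub_mem (nsmul_mem ha 2) heM) h2 h3
    refine ⟨(1 / 2 : NNReal) • (e + v), Submodule.smul_mem _ _
      (add_mem (Submodule.subset_span ⟨heM, he⟩) hv), ?_⟩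
    have : a - (1 / 2 : NNReal) • (e + v) = (1 / 2 : ℝ) • (2 • a - e - v) := by
      rw [NNReal.smul_def]
      push_cast
      module
    rw [this, norm_smul, pow_succ']
    refine mul_le_mul ?_ hav (norm_nonneg _) (by norm_num)
    norm_num

/-- Every positive element of a von Neumann algebra is a norm limit of positive combinations of
its projections. -/
theorem VonNeumannAlgebra.mem_closure_projCone (M : VonNeumannAlgebra H) {a : H →L[ℂ] H}
    (ha : a ∈ M) (h0 : 0 ≤ a) : a ∈ closure (projCone (M : Set (H →L[ℂ] H)) : Set (H →L[ℂ] H)) := by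
  have unit : ∀ a ∈ M, 0 ≤ a → a ≤ 1 →
      a ∈ closure (projCone (M : Set (H →L[ℂ] H)) : Set (H →L[ℂ] H)) := by
    intro a ha h0 h1
    rw [Metric.mem_closure_iff]
    intro ε hε
    obtain ⟨k, hk⟩ := exists_pow_lt_of_lt_one hε (by norm_num : (1 / 2 : ℝ) < 1)
    obtain ⟨v, hv, hav⟩ := M.exists_projCone_near k a ha h0 h1
    exact ⟨v, hv, by rw [dist_eq_norm]; exact hav.trans_lt hk⟩
  -- The summand 1 keeps `r` invertible when `a = 0`.
  let r : NNReal := ⟨‖a‖ + 1, by positivity⟩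
  have hr : (0 : ℝ) < ‖a‖ + 1 := by positivity
  have hb0 : 0 ≤ (r⁻¹ : NNReal) • a := smul_nonneg (zero_le (a := (r⁻¹ : NNReal))) h0
  have hbM : (r⁻¹ : NNReal) • a ∈ M := by
    have : (r⁻¹ : NNReal) • a = ((r⁻¹ : NNReal) : ℂ) • a := rfl
    rw [this]
    exact M.toStarSubalgebra.smul_mem ha _
  have hb1 : (r⁻¹ : NNReal) • a ≤ 1 := by
    rw [← CStarAlgebra.norm_le_one_iff_of_nonneg _ hb0, NNReal.smul_def, norm_smul]
    change ‖((‖a‖ + 1)⁻¹ : ℝ)‖ * ‖a‖ ≤ 1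
    rw [norm_inv, Real.norm_of_nonneg hr.le, inv_mul_le_iff₀ hr]
    linarith
  have h := unit _ hbM hb0 hb1
  have h2 : a = r • (r⁻¹ : NNReal) • a := by
    rw [smul_smul, mul_inv_cancel₀ (by exact fun h => hr.ne' (congrArg NNReal.toReal h)), one_smul]
  rw [h2]
  exact map_mem_closure (continuous_const_smul r) h fun v hv => Submodule.smul_mem _ r hv

end Projections

/-! ### Complete Boolean algebras of projections and their bicommutants -/

section Bicommutant
variable {H : Type u} [NormedAddCommGroup H] [InnerProductSpace ℂ H] [CompleteSpace H]

theorem IsStarProjection.eq_of_ker {p q : H →L[ℂ] H} (hp : IsStarProjection p)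
    (hq : IsStarProjection q) (h : ∀ x, p x = 0 ↔ q x = 0) : p = q := by
  have : 1 - p = 1 - q := hp.one_sub.eq_of_fixed hq.one_sub fun x => by
    change x - p x = x ↔ x - q x = x
    rw [sub_eq_self, sub_eq_self, h]
  exact sub_right_inj.mp this

theorem mul_eq_right_of_fixed {p q : H →L[ℂ] H} (hq : IsStarProjection q)
    (h : ∀ x, q x = x → p x = x) : p * q = q := by
  ext x
  exact h _ (hq.apply_apply x)

theorem IsStarProjection.mul_eq_right_comm {p q : H →L[ℂ] H} (hp : IsStarProjection p)
    (hq : IsStarProjection q) (h : p * q = q) : q * p = q := by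
  have := congrArg star h
  rwa [star_mul, hp.isSelfAdjoint.star_eq, hq.isSelfAdjoint.star_eq] at this

theorem IsStarProjection.norm_add_apply_sq {s r : H →L[ℂ] H} (hs : IsStarProjection s)
    (hr : IsStarProjection r) (hsr : IsStarProjection (s + r)) (x : H) :
    ‖(s + r) x‖ ^ 2 = ‖s x‖ ^ 2 + ‖r x‖ ^ 2 := by
  have h := hsr.inner_apply_self x
  rw [add_apply, inner_add_right, hs.inner_apply_self, hr.inner_apply_self] at h
  exact_mod_cast h.symm

/-- An operator of the bicommutant maps every vector into its cyclic subspace. -/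
theorem apply_mem_closure_cyclic (B : StarSubalgebra ℂ (H →L[ℂ] H)) {p : H →L[ℂ] H}
    (hp : p ∈ (B : Set (H →L[ℂ] H)).centralizer.centralizer) (z : H) :
    p z ∈ closure ((fun b : H →L[ℂ] H => b z) '' (B : Set (H →L[ℂ] H))) := by
  let ev : (H →L[ℂ] H) →ₗ[ℂ] H := ContinuousLinearMap.apply ℂ H z
  let K₀ : Submodule ℂ H := (Subalgebra.toSubmodule B.toSubalgebra).map ev
  let K : Submodule ℂ H := K₀.topologicalClosure
  have hKc : IsClosed (K : Set H) := K₀.isClosed_topologicalClosure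
  have : CompleteSpace K := hKc.completeSpace_coe
  have hinv : ∀ b ∈ B, ∀ x ∈ K, b x ∈ K := by
    intro b hb x hx
    refine map_mem_closure b.continuous hx ?_
    rintro _ ⟨c, hc, rfl⟩
    exact ⟨b * c, B.mul_mem hb hc, rfl⟩
  set P := K.starProjection with hP
  have hPs : IsStarProjection P := isStarProjection_starProjection
  have hPx : ∀ x, P x ∈ K := fun x => Submodule.starProjection_apply_mem K x
  have hPfix : ∀ x ∈ K, P x = x := fun x hx => Submodule.starProjection_eq_self_iff.mpr hx
  have hPb : ∀ b ∈ B, P * b * P = b * P := by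
    intro b hb
    ext x
    exact hPfix _ (hinv b hb _ (hPx x))
  -- The cyclic subspace is invariant under `b` and under `b*`, so its projection commutes with `b`.
  have hcom : P ∈ (B : Set (H →L[ℂ] H)).centralizer := by
    intro b hb
    have h1 := congrArg star (hPb (star b) (star_mem hb))
    simp only [star_mul, star_star, hPs.isSelfAdjoint.star_eq] at h1
    rw [← hPb b hb, mul_assoc, h1]
  have hz : P z = z := hPfix z (subset_closure ⟨1, B.one_mem, rfl⟩)
  have h1 : P (p z) = p (P z) := congrArg (fun T : H →L[ℂ] H => T z) (hp P hcom)
  rw [hz] at h1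
  rw [← h1]
  exact hPx (p z)

/-- The bounds `‖r y‖² ≤ n ‖r x‖²` for projections `r` extend to positive operators. -/
theorem norm_apply_sq_le_of_projCone {B : Set (H →L[ℂ] H)} {n : ℝ} {x y : H}
    (h : ∀ r ∈ B, IsStarProjection r → ‖r y‖ ^ 2 ≤ n * ‖r x‖ ^ 2) {b : H →L[ℂ] H}
    (hb : star b * b ∈ closure (projCone B : Set (H →L[ℂ] H))) :
    ‖b y‖ ^ 2 ≤ n * ‖b x‖ ^ 2 := by
  -- The hypothesis says that this continuous real-linear functional is nonnegative on the
  -- projections of `B`, hence on the closed cone that they generate. At `b* b` its value is `n ‖b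
  -- x‖² - ‖b y‖²`.
  let φ : (H →L[ℂ] H) → ℝ := fun T => n * (⟪x, T x⟫_ℂ).re - (⟪y, T y⟫_ℂ).re
  have hφ : Continuous φ := by
    have hev : ∀ z : H, Continuous fun T : H →L[ℂ] H => T z :=
      fun z => (ContinuousLinearMap.apply ℂ H z).continuous
    have h1 : ∀ z : H, Continuous fun T : H →L[ℂ] H => (⟪z, T z⟫_ℂ).re :=
      fun z => Complex.continuous_re.comp (continuous_const.inner (hev z))
    exact (continuous_const.mul (h1 x)).sub (h1 y)
  have hcone : ∀ T ∈ projCone B, 0 ≤ φ T := by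
    intro T hT
    induction hT using Submodule.span_induction with
    | mem r hr =>
      simp only [φ, hr.2.inner_apply_self, Complex.ofReal_re]
      exact sub_nonneg.mpr (h r hr.1 hr.2)
    | zero => simp [φ]
    | add S T _ _ hS hT =>
      have : φ (S + T) = φ S + φ T := by
        simp only [φ, add_apply, inner_add_right, Complex.add_re]; ring
      rw [this]; exact add_nonneg hS hT
    | smul c T _ hT =>
      have : φ (c • T) = c * φ T := by
        have hc : c • T = ((c : ℝ) : ℂ) • T := rfl
        simp only [φ, hc, smul_apply, inner_smul_right, Complex.re_ofReal_mul]
        ring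
      rw [this]; exact mul_nonneg c.2 hT
  have hφb : 0 ≤ φ (star b * b) :=
    closure_minimal (t := φ ⁻¹' Set.Ici 0) hcone (isClosed_Ici.preimage hφ) hb
  have hin : ∀ z : H, (⟪z, (star b * b) z⟫_ℂ).re = ‖b z‖ ^ 2 := by
    intro z
    change (⟪z, (star b) (b z)⟫_ℂ).re = _
    rw [ContinuousLinearMap.star_eq_adjoint, ContinuousLinearMap.adjoint_inner_right]
    exact inner_self_eq_norm_sq (𝕜 := ℂ) (b z)
  simp only [φ, hin] at hφb
  exact sub_nonneg.mp hφb

/-- The projections in `B` are closed under infima in the lattice of all projections. -/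
def ProjComplete (B : Set (H →L[ℂ] H)) : Prop :=
  ∀ S ⊆ {q | q ∈ B ∧ IsStarProjection q}, ∃ g ∈ B, IsStarProjection g ∧
    ∀ x, g x = x ↔ ∀ q ∈ S, q x = x

-- The kernel condition identifies `s` as the projection onto the closed span of the ranges of the
-- members of `c`. These ranges increase along `c`, hence the strong convergence, which lets
-- inequalities between vector measures pass to the supremum of a chain.
open Filter Topology in
theorem tendsto_projection_of_ker {c : Set (H →L[ℂ] H)}
    (hcp : ∀ q ∈ c, IsStarProjection q) {s : H →L[ℂ] H} (hs : IsStarProjection s)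
    (hker : ∀ x, s x = 0 ↔ ∀ q ∈ c, q x = 0) (x : H) :
    Tendsto (fun q : c => q.1 x) atTop (𝓝 (s x)) := by
  let U : c → Submodule ℂ H := fun q => q.1.range
  have hU : ∀ q : c, IsClosed (U q : Set H) := fun q =>
    ContinuousLinearMap.IsIdempotentElem.isClosed_range (hcp q q.2).isIdempotentElem
  have : ∀ q : c, CompleteSpace (U q) := fun q => (hU q).completeSpace_coe
  have hUq : ∀ q : c, (U q).starProjection = q.1 := fun q =>
    (isStarProjection_iff_eq_starProjection_range.mp (hcp q q.2)).2.symm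
  have hmono : Monotone U := by
    intro q r hqr
    rw [← Submodule.starProjection_le_starProjection_iff, hUq, hUq]
    exact hqr
  have hcl : IsClosed ((⨆ q, U q).topologicalClosure : Set H) :=
    Submodule.isClosed_topologicalClosure _
  have : CompleteSpace (⨆ q, U q).topologicalClosure := hcl.completeSpace_coe
  have hsup : (⨆ q, U q).topologicalClosure.starProjection = s := by
    refine isStarProjection_starProjection.eq_of_ker hs fun x => ?_
    rw [Submodule.starProjection_apply_eq_zero_iff, Submodule.orthogonal_closure,
      ← Submodule.iInf_orthogonal, Submodule.mem_iInf, hker, Subtype.forall]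
    refine forall₂_congr fun q hq => ?_
    rw [← Submodule.starProjection_apply_eq_zero_iff, hUq]
  have := Submodule.starProjection_tendsto_closure_iSup U hmono x
  rw [hsup] at this
  simpa only [hUq] using this

/-- A Hahn decomposition for the vector measures of `x` and `y` on a complete Boolean algebra of
projections. -/
theorem ProjComplete.exists_hahn {B : StarSubalgebra ℂ (H →L[ℂ] H)}
    (hB : ProjComplete (B : Set (H →L[ℂ] H))) (x y : H) (n : ℝ) :
    ∃ s ∈ B, IsStarProjection s ∧ n * ‖s x‖ ^ 2 ≤ ‖s y‖ ^ 2 ∧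
      ∀ r ∈ B, IsStarProjection r → r * s = 0 → ‖r y‖ ^ 2 ≤ n * ‖r x‖ ^ 2 := by
  let S : Set (H →L[ℂ] H) := {s | s ∈ B ∧ IsStarProjection s ∧ n * ‖s x‖ ^ 2 ≤ ‖s y‖ ^ 2}
  have h0 : (0 : H →L[ℂ] H) ∈ S := ⟨B.zero_mem, IsStarProjection.zero _, by simp⟩
  -- Zorn's lemma gives a maximal element of `S`. The upper bound of a chain is `1 - t`, with `t`
  -- the infimum of the complements; the defining inequality survives the strong limit.
  obtain ⟨s, -, hs⟩ := zorn_le_nonempty₀ S (fun c hcS hc y₀ hy₀ => by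
    obtain ⟨t, htB, ht, hfix⟩ := hB ((fun q => 1 - q) '' c) (by
      rintro _ ⟨q, hq, rfl⟩
      exact ⟨sub_mem B.one_mem (hcS hq).1, (hcS hq).2.1.one_sub⟩)
    have hker : ∀ z, (1 - t) z = 0 ↔ ∀ q ∈ c, q z = 0 := by
      intro z
      change z - t z = 0 ↔ _
      rw [sub_eq_zero, eq_comm, hfix, Set.forall_mem_image]
      refine forall₂_congr fun q _ => ?_
      change z - q z = z ↔ _
      rw [sub_eq_self]
    have htend := tendsto_projection_of_ker (fun q hq => (hcS hq).2.1) ht.one_sub hker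
    have : Nonempty c := ⟨⟨y₀, hy₀⟩⟩
    have : IsDirectedOrder c := ⟨fun a b => by
      rcases hc.total a.2 b.2 with h | h
      · exact ⟨b, h, le_rfl⟩
      · exact ⟨a, le_rfl, h⟩⟩
    refine ⟨1 - t, ⟨sub_mem B.one_mem htB, ht.one_sub, ?_⟩, fun q hq => ?_⟩
    · exact le_of_tendsto_of_tendsto' (((htend x).norm.pow 2).const_mul n)
        ((htend y).norm.pow 2) fun q => (hcS q.2).2.2
    · exact (hcS hq).2.1.le_of_mul_eq_left ht.one_sub
        (mul_eq_self_of_ker ht.one_sub fun z hz => (hker z).mp hz q hq)) 0 h0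
  refine ⟨s, hs.prop.1, hs.prop.2.1, hs.prop.2.2, fun r hrB hr hrs => ?_⟩
  -- A projection `r` orthogonal to `s` that violates the bound could be added to `s` within `S`, so
  -- maximality gives `r = 0`.
  by_contra hlt
  rw [not_le] at hlt
  have hsr : s * r = 0 := by
    have := congrArg star hrs
    rwa [star_mul, hr.isSelfAdjoint.star_eq, hs.prop.2.1.isSelfAdjoint.star_eq, star_zero] at this
  have hadd : IsStarProjection (s + r) := hs.prop.2.1.add hr hsr
  have hmem : s + r ∈ S := by
    refine ⟨add_mem hs.prop.1 hrB, hadd, ?_⟩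
    rw [hs.prop.2.1.norm_add_apply_sq hr hadd, hs.prop.2.1.norm_add_apply_sq hr hadd, mul_add]
    exact add_le_add hs.prop.2.2 hlt.le
  have hle : s + r ≤ s := hs.le_of_ge hmem (le_add_of_nonneg_right hr.nonneg)
  have hr0 : r = 0 := le_antisymm (by simpa using hle) hr.nonneg
  simp [hr0] at hlt

section
variable {B : StarSubalgebra ℂ (H →L[ℂ] H)}

/-- Since `x = p (x + y)`, the vector `x` is a limit of vectors `b (x + y)` with `b ∈ B`. Applying
`p` and `1 - p`, which commute with `b`, shows that `b x` is close to `x` and `b y` is close to `0`.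
Domination, extended from projections to `1 - b`, then makes `(1 - b) y` small as well, and `y = b y
+ (1 - b) y`. -/
theorem eq_zero_of_domination (hcomm : ∀ x ∈ B, ∀ y ∈ B, x * y = y * x)
    (hcone : ∀ b ∈ B, star b * b ∈ closure (projCone (B : Set (H →L[ℂ] H)) : Set (H →L[ℂ] H)))
    {p : H →L[ℂ] H} (hp : IsStarProjection p)
    (hpB : p ∈ (B : Set (H →L[ℂ] H)).centralizer.centralizer) {x y : H}
    (hx : p x = x) (hy : p y = 0) {n : ℝ} (hn : 0 ≤ n)
    (hdom : ∀ r ∈ B, IsStarProjection r → ‖r y‖ ^ 2 ≤ n * ‖r x‖ ^ 2) : y = 0 := by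
  have hBc : ∀ b ∈ B, ∀ z, p (b z) = b (p z) := fun b hb z => by
    have hb' : b ∈ (B : Set (H →L[ℂ] H)).centralizer := fun c hc => hcomm c hc b hb
    exact (congrArg (fun T : H →L[ℂ] H => T z) (hpB b hb')).symm
  have key : ∀ ε : ℝ, 0 < ε → ‖y‖ ≤ ε + (n + 1) * ε := by
    intro ε hε
    obtain ⟨_, ⟨b, hb, rfl⟩, hbd⟩ :=
      Metric.mem_closure_iff.mp (apply_mem_closure_cyclic B hpB (x + y)) ε hε
    have hz : p (x + y) = x := by rw [map_add, hx, hy, add_zero]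
    rw [hz, dist_eq_norm] at hbd
    have h1 : p (x - b (x + y)) = x - b x := by rw [map_sub, hBc b hb, hx, hz]
    have h2 : (1 - p) (x - b (x + y)) = - b y := by
      change (x - b (x + y)) - p (x - b (x + y)) = _
      rw [h1, map_add]; abel
    have h3 : ‖b y‖ ≤ ε := by
      rw [← norm_neg, ← h2]; exact (hp.one_sub.norm_apply_le _).trans hbd.le
    have h4 : ‖(1 - b) x‖ ≤ ε := by
      have : (1 - b) x = x - b x := rfl
      rw [this, ← h1]; exact (hp.norm_apply_le _).trans hbd.le
    have h5 := norm_apply_sq_le_of_projCone hdom (hcone (1 - b) (sub_mem B.one_mem hb))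
    -- The square is at most `n ε²`; the estimate `n ≤ (n + 1)²` avoids a square root.
    have h6 : ‖(1 - b) y‖ ≤ (n + 1) * ε := by
      refine abs_le_of_sq_le_sq' ?_ (by positivity) |>.2
      have : ‖(1 - b) x‖ ^ 2 ≤ ε ^ 2 := pow_le_pow_left₀ (norm_nonneg _) h4 2
      nlinarith [mul_le_mul_of_nonneg_left this hn, sq_nonneg ε, mul_nonneg hn (sq_nonneg ε),
        mul_nonneg (mul_nonneg hn hn) (sq_nonneg ε)]
    have h7 : y = b y + (1 - b) y := by
      change y = b y + (y - b y); abel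
    calc ‖y‖ = ‖b y + (1 - b) y‖ := by rw [← h7]
      _ ≤ _ := (norm_add_le _ _).trans (add_le_add h3 h6)
  by_contra hne
  have hpos : 0 < ‖y‖ := norm_pos_iff.mpr hne
  -- With this `ε` the bound `(n + 2) ε` equals `‖y‖ / 2`.
  have := key (‖y‖ / (2 * (n + 2))) (by positivity)
  have h8 : ‖y‖ / (2 * (n + 2)) + (n + 1) * (‖y‖ / (2 * (n + 2))) = ‖y‖ / 2 := by
    field_simp; ring
  linarith

/-- A Lebesgue decomposition argument. The Hahn projection `s n` satisfies `n ‖s n x‖² ≤ ‖s n y‖²`,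
and on its complement the measure of `y` is dominated by `n` times that of `x`, so `(1 - s n) y =
0`. The infimum `t` of all `s n` then fixes `y` and, by letting `n` grow, kills `x`. Thus `1 - t`
fixes `x`, hence also `y`, which leaves `y = 0`. -/
theorem eq_zero_of_support (hcomm : ∀ x ∈ B, ∀ y ∈ B, x * y = y * x)
    (hcone : ∀ b ∈ B, star b * b ∈ closure (projCone (B : Set (H →L[ℂ] H)) : Set (H →L[ℂ] H)))
    (hB : ProjComplete (B : Set (H →L[ℂ] H)))
    {p : H →L[ℂ] H} (hp : IsStarProjection p)
    (hpB : p ∈ (B : Set (H →L[ℂ] H)).centralizer.centralizer) {x y : H}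
    (hx : p x = x) (hy : p y = 0)
    (hsupp : ∀ q ∈ B, IsStarProjection q → q x = x → q y = y) : y = 0 := by
  have hBc : ∀ b ∈ B, ∀ z, p (b z) = b (p z) := fun b hb z => by
    have hb' : b ∈ (B : Set (H →L[ℂ] H)).centralizer := fun c hc => hcomm c hc b hb
    exact (congrArg (fun T : H →L[ℂ] H => T z) (hpB b hb')).symm
  have hs : ∀ n : ℕ, ∃ s ∈ B, IsStarProjection s ∧ n * ‖s x‖ ^ 2 ≤ ‖y‖ ^ 2 ∧ s y = y := by
    intro n
    obtain ⟨s, hsB, hs, hle, hmax⟩ := hB.exists_hahn x y n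
    have hqB : 1 - s ∈ B := sub_mem B.one_mem hsB
    have hq := hs.one_sub
    have hzero : (1 - s) y = 0 := by
      refine eq_zero_of_domination hcomm hcone hp hpB (x := (1 - s) x) (n := n) ?_ ?_
        (Nat.cast_nonneg n) fun r hrB hr => ?_
      · rw [hBc _ hqB, hx]
      · rw [hBc _ hqB, hy, map_zero]
      · refine hmax (r * (1 - s)) (mul_mem hrB hqB) (hr.mul hq (hcomm r hrB _ hqB)) ?_
        rw [mul_assoc, hs.one_sub_mul_self, mul_zero]
    have hsy : s y = y := (sub_eq_zero.mp hzero).symm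
    exact ⟨s, hsB, hs, by rwa [hsy] at hle, hsy⟩
  choose s hsB hs hle hsy using hs
  obtain ⟨t, htB, ht, hfix⟩ := hB (Set.range s) (by rintro _ ⟨n, rfl⟩; exact ⟨hsB n, hs n⟩)
  have hty : t y = y := (hfix y).mpr (by rintro _ ⟨n, rfl⟩; exact hsy n)
  have htx : t x = 0 := by
    by_contra hne
    have hpos : 0 < ‖t x‖ ^ 2 := by positivity
    obtain ⟨n, hn⟩ := exists_nat_gt (‖y‖ ^ 2 / ‖t x‖ ^ 2)
    rw [div_lt_iff₀ hpos] at hn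
    have h1 : t * s n = t := (hs n).mul_eq_right_comm ht
      (mul_eq_right_of_fixed ht fun z hz => (hfix z).mp hz _ ⟨n, rfl⟩)
    have h2 : ‖t x‖ ≤ ‖s n x‖ := by
      conv_lhs => rw [← h1]
      exact ht.norm_apply_le _
    have h3 : ‖t x‖ ^ 2 ≤ ‖s n x‖ ^ 2 := pow_le_pow_left₀ (norm_nonneg _) h2 2
    have := mul_le_mul_of_nonneg_left h3 (Nat.cast_nonneg (α := ℝ) n)
    linarith [hle n]
  have h1 : (1 - t) y = y := hsupp (1 - t) (sub_mem B.one_mem htB) ht.one_sub (by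
    change x - t x = x
    rw [htx, sub_zero])
  have h2 : y - t y = y := h1
  rw [hty, sub_self] at h2
  exact h2.symm

/-- A complete Boolean algebra of projections contains all projections of the von Neumann algebra
that it generates. -/
theorem projection_mem_of_bicommutant (hcomm : ∀ x ∈ B, ∀ y ∈ B, x * y = y * x)
    (hcone : ∀ b ∈ B, star b * b ∈ closure (projCone (B : Set (H →L[ℂ] H)) : Set (H →L[ℂ] H)))
    (hB : ProjComplete (B : Set (H →L[ℂ] H)))
    {p : H →L[ℂ] H} (hp : IsStarProjection p)
    (hpB : p ∈ (B : Set (H →L[ℂ] H)).centralizer.centralizer) : p ∈ B := by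
  have hBc : ∀ b ∈ B, ∀ z, p (b z) = b (p z) := fun b hb z => by
    have hb' : b ∈ (B : Set (H →L[ℂ] H)).centralizer := fun c hc => hcomm c hc b hb
    exact (congrArg (fun T : H →L[ℂ] H => T z) (hpB b hb')).symm
  -- The projection `g` is the least one of `B` above `1 - p`; the aim is `g = 1 - p`.
  obtain ⟨g, hgB, hg, hgfix⟩ :=
    hB {q | (q ∈ B ∧ IsStarProjection q) ∧ ∀ y, p y = 0 → q y = y} fun q hq => hq.1
  have hgp : ∀ x, g x = x ↔ p x = 0 := by
    refine fun x => ⟨fun hx => ?_, fun hx => (hgfix x).mpr fun q hq => hq.2 x hx⟩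
    -- The projection `e` is the least one of `B` that fixes `p x`. If `p y = 0`, every projection
    -- of `B` fixing `p x` fixes `e y`, so `e y = 0`. Hence `1 - e` lies above `1 - p`, so `g` lies
    -- below `1 - e`; this gives `e x = 0` and then `p x = p (e x) = 0`.
    obtain ⟨e, heB, he, hefix⟩ :=
      hB {q | (q ∈ B ∧ IsStarProjection q) ∧ q (p x) = p x} fun q hq => hq.1
    have hpx : e (p x) = p x := (hefix _).mpr fun q hq => hq.2
    have hmem : ∀ y, p y = 0 → (1 - e) y = y := by
      intro y hy
      change y - e y = y
      rw [sub_eq_self]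
      refine eq_zero_of_support hcomm hcone hB hp hpB (hp.apply_apply x)
        (by rw [hBc e heB, hy, map_zero]) fun q hqB hq hqx => ?_
      exact (hefix (e y)).mp (he.apply_apply y) q ⟨⟨hqB, hq⟩, hqx⟩
    have h1 : x - e x = x :=
      (hgfix x).mp hx (1 - e) ⟨⟨sub_mem B.one_mem heB, he.one_sub⟩, hmem⟩
    rw [sub_eq_self] at h1
    rw [← hpx, ← hBc e heB, h1, map_zero]
  have : g = 1 - p := hg.eq_of_fixed hp.one_sub fun x => by
    rw [hgp]
    change _ ↔ x - p x = x
    rw [sub_eq_self]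
  have hp' : p = 1 - g := by rw [this, sub_sub_cancel]
  rw [hp']
  exact sub_mem B.one_mem hgB

end

/-- Decomposition into real and imaginary, then positive and negative parts leaves positive
elements, which are norm limits of combinations of projections. A bicommutant therefore needs to be
examined only at its projections. -/
theorem VonNeumannAlgebra.subset_of_projections (M : VonNeumannAlgebra H)
    {B : StarSubalgebra ℂ (H →L[ℂ] H)} (hB : IsClosed (B : Set (H →L[ℂ] H)))
    (h : ∀ p ∈ M, IsStarProjection p → p ∈ B) : (M : Set (H →L[ℂ] H)) ⊆ B := by
  have hM : IsClosed (M.toStarSubalgebra : Set (H →L[ℂ] H)) := M.isClosed_coe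
  have hpos : ∀ a ∈ M, 0 ≤ a → a ∈ B := by
    intro a ha h0
    refine closure_minimal ?_ hB (M.mem_closure_projCone ha h0)
    intro v hv
    induction hv using Submodule.span_induction with
    | mem r hr => exact h r hr.1 hr.2
    | zero => exact B.zero_mem
    | add S T _ _ hS hT => exact add_mem hS hT
    | smul c T _ hT => exact B.smul_mem hT ((c : ℝ) : ℂ)
  have hsa : ∀ a ∈ M, IsSelfAdjoint a → a ∈ B := by
    intro a ha hsa
    have h1 : cfc (fun t : ℝ => max t 0) a ∈ M.toStarSubalgebra := cfc_mem (𝕜' := ℂ) _ ha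
    have h2 : cfc (fun t : ℝ => max (-t) 0) a ∈ M.toStarSubalgebra := cfc_mem (𝕜' := ℂ) _ ha
    have h3 : a = cfc (fun t : ℝ => max t 0) a - cfc (fun t : ℝ => max (-t) 0) a := by
      rw [← cfc_sub (fun t : ℝ => max t 0) (fun t : ℝ => max (-t) 0) a]
      conv_lhs => rw [← cfc_id' ℝ a]
      congr 1
      ext t
      rcases le_total t 0 with ht | ht
      · rw [max_eq_right ht, max_eq_left (by linarith)]; ring
      · rw [max_eq_left ht, max_eq_right (by linarith)]; ring
    rw [h3]
    exact sub_mem (hpos _ h1 (cfc_nonneg fun t _ => le_max_right _ _))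
      (hpos _ h2 (cfc_nonneg fun t _ => le_max_right _ _))
  intro a ha
  have h1 : ((realPart a : selfAdjoint (H →L[ℂ] H)) : H →L[ℂ] H) ∈ M := by
    rw [realPart_apply_coe]
    exact M.toStarSubalgebra.smul_mem (add_mem ha (star_mem ha)) (((2⁻¹ : ℝ)) : ℂ)
  have h2 : ((imaginaryPart a : selfAdjoint (H →L[ℂ] H)) : H →L[ℂ] H) ∈ M := by
    rw [imaginaryPart_apply_coe]
    exact M.toStarSubalgebra.smul_mem (M.toStarSubalgebra.smul_mem
      (sub_mem ha (star_mem ha)) (((2⁻¹ : ℝ)) : ℂ)) _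
  rw [← realPart_add_I_smul_imaginaryPart a]
  exact add_mem (hsa _ h1 (realPart a).2) (B.smul_mem (hsa _ h2 (imaginaryPart a).2) _)

end Bicommutant

/-! ### The image of a context under an automorphism -/

section ImageContext
variable {H : Type u} [NormedAddCommGroup H] [InnerProductSpace ℂ H] [CompleteSpace H]
variable {A : VonNeumannAlgebra H}

namespace Proj

/-- The projection `h(p)`, for a projection `p` of `A`. -/
noncomputable def map (h : A.toStarSubalgebra ≃⋆ₐ[ℂ] A.toStarSubalgebra) (p : Proj A) : Proj A :=
  ⟨h ⟨p.1, p.2.1⟩, (h ⟨p.1, p.2.1⟩).2, by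
    have : IsStarProjection (⟨p.1, p.2.1⟩ : A.toStarSubalgebra) :=
      ⟨Subtype.ext p.2.2.isIdempotentElem, Subtype.ext p.2.2.isSelfAdjoint⟩
    exact (this.map h).map A.toStarSubalgebra.subtype⟩

@[simp]
theorem map_symm_map (h : A.toStarSubalgebra ≃⋆ₐ[ℂ] A.toStarSubalgebra) (p : Proj A) :
    map h.symm (map h p) = p :=
  Subtype.ext (congrArg (fun z : A.toStarSubalgebra => (z : H →L[ℂ] H))
    (h.symm_apply_apply ⟨p.1, p.2.1⟩))

@[simp]
theorem map_map_symm (h : A.toStarSubalgebra ≃⋆ₐ[ℂ] A.toStarSubalgebra) (p : Proj A) :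
    map h (map h.symm p) = p :=
  Subtype.ext (congrArg (fun z : A.toStarSubalgebra => (z : H →L[ℂ] H))
    (h.apply_symm_apply ⟨p.1, p.2.1⟩))

theorem map_mono (h : A.toStarSubalgebra ≃⋆ₐ[ℂ] A.toStarSubalgebra) {p q : Proj A} (hpq : p ≤ q) :
    map h p ≤ map h q := by
  have h1 : p.1 * q.1 = p.1 := (p.2.2.le_iff_mul_eq_left q.2.2).mp hpq
  refine (map h p).2.2.le_of_mul_eq_left (map h q).2.2 ?_
  have h2 : (⟨p.1, p.2.1⟩ : A.toStarSubalgebra) * ⟨q.1, q.2.1⟩ = ⟨p.1, p.2.1⟩ := Subtype.ext h1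
  exact congrArg Subtype.val ((map_mul h _ _).symm.trans (congrArg h h2))

/-- The order automorphism of the projection lattice induced by a `*`-automorphism. -/
noncomputable def mapIso (h : A.toStarSubalgebra ≃⋆ₐ[ℂ] A.toStarSubalgebra) :
    Proj A ≃o Proj A where
  toFun := map h
  invFun := map h.symm
  left_inv := map_symm_map h
  right_inv := map_map_symm h
  map_rel_iff' {p q} := by
    refine ⟨fun hpq => ?_, map_mono h⟩
    have := map_mono h.symm hpq
    change map h.symm (map h p) ≤ map h.symm (map h q) at this
    rwa [map_symm_map, map_symm_map] at this

end Proj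

/-- The infimum of a set of projections fixes exactly the vectors that all of them fix. -/
theorem IsGLB.apply_eq_self_iff {C : VonNeumannAlgebra H} {S : Set (Proj C)} {g : Proj C}
    (hg : IsGLB S g) (x : H) : g.1 x = x ↔ ∀ q ∈ S, q.1 x = x := by
  constructor
  · intro hx q hq
    have : q.1 * g.1 = g.1 := (g.2.2.le_iff_mul_eq_right q.2.2).mp (hg.1 hq)
    have := congrArg (fun T : H →L[ℂ] H => T x) this
    change q.1 (g.1 x) = g.1 x at this
    rwa [hx] at this
  · intro hx
    -- The projection onto the line of `x` lies below every member of `S`. It need not belong to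
    -- `C`, but `IsGLB.le_of_proj` compares `g` with all projections on `H`.
    let r : H →L[ℂ] H := (ℂ ∙ x).starProjection
    have hr : IsStarProjection r := isStarProjection_starProjection
    have hrx : r x = x :=
      Submodule.starProjection_eq_self_iff.mpr (Submodule.mem_span_singleton_self x)
    have hle : r ≤ g.1 := hg.le_of_proj hr fun q hq => by
      refine hr.le_of_mul_eq_right q.2.2 ?_
      refine mul_eq_right_of_fixed hr fun y hy => ?_
      obtain ⟨c, rfl⟩ := Submodule.mem_span_singleton.mp
        (Submodule.starProjection_eq_self_iff.mp hy)
      rw [map_smul, hx q hq]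
    have := (hr.le_iff_mul_eq_right g.2.2).mp hle
    have := congrArg (fun T : H →L[ℂ] H => T x) this
    change g.1 (r x) = r x at this
    rwa [hrx] at this

namespace Context

/-- A projection of a context, regarded as a projection of `A`. -/
def projIncl (C : Context A) (q : Proj C.toVN) : Proj A := ⟨q.1, C.le q.2.1, q.2.2⟩

theorem isGLB_projIncl (C : Context A) {S : Set (Proj C.toVN)} {g : Proj C.toVN}
    (hg : IsGLB S g) : IsGLB (C.projIncl '' S) (C.projIncl g) := by
  refine ⟨?_, fun r hr => ?_⟩
  · rintro _ ⟨q, hq, rfl⟩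
    exact hg.1 hq
  · exact hg.le_of_proj r.2.2 fun q hq => hr ⟨q, hq, rfl⟩

/-- The isometric `*`-homomorphism `c ↦ h(c)` from a context to the bounded operators. -/
noncomputable def imageHom (h : A.toStarSubalgebra ≃⋆ₐ[ℂ] A.toStarSubalgebra) (C : Context A) :
    C.alg →⋆ₐ[ℂ] (H →L[ℂ] H) :=
  (A.toStarSubalgebra.subtype.comp (h : A.toStarSubalgebra →⋆ₐ[ℂ] A.toStarSubalgebra)).comp C.inclA

theorem imageHom_injective (h : A.toStarSubalgebra ≃⋆ₐ[ℂ] A.toStarSubalgebra) (C : Context A) :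
    Function.Injective (C.imageHom h) := by
  intro c d hcd
  have h1 : C.inclA c = C.inclA d := h.injective (Subtype.ext hcd)
  exact Subtype.ext (congrArg (fun z : A.toStarSubalgebra => (z : H →L[ℂ] H)) h1)

theorem isometry_imageHom (h : A.toStarSubalgebra ≃⋆ₐ[ℂ] A.toStarSubalgebra) (C : Context A) :
    Isometry (C.imageHom h) :=
  NonUnitalStarAlgHom.isometry (C.imageHom h) (C.imageHom_injective h)

theorem coe_range_imageHom (h : A.toStarSubalgebra ≃⋆ₐ[ℂ] A.toStarSubalgebra) (C : Context A) :
    ((C.imageHom h).range : Set (H →L[ℂ] H)) = C.imageSet h :=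
  rfl

theorem map_projIncl_mem (h : A.toStarSubalgebra ≃⋆ₐ[ℂ] A.toStarSubalgebra) (C : Context A)
    (q : Proj C.toVN) : (Proj.map h (C.projIncl q)).1 ∈ C.imageSet h :=
  ⟨⟨q.1, q.2.1⟩, rfl⟩

theorem exists_map_projIncl (h : A.toStarSubalgebra ≃⋆ₐ[ℂ] A.toStarSubalgebra) (C : Context A)
    {p : H →L[ℂ] H} (hp : p ∈ C.imageSet h) (hps : IsStarProjection p) :
    ∃ q : Proj C.toVN, (Proj.map h (C.projIncl q)).1 = p := by
  obtain ⟨c, rfl⟩ := hp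
  have hc : IsStarProjection c := by
    refine ⟨C.imageHom_injective h ?_, C.imageHom_injective h ?_⟩
    · rw [map_mul]; exact hps.isIdempotentElem
    · rw [map_star]; exact hps.isSelfAdjoint
  exact ⟨⟨c.1, c.2, hc.map C.alg.subtype⟩, rfl⟩

/-- The infimum is taken in `C`, where it is also an infimum in `A`, and is carried over by the
order automorphism `Proj.mapIso h`. Infima in `A` are determined by fixed vectors, so the result is
an infimum on `H`. -/
theorem projComplete_imageSet (h : A.toStarSubalgebra ≃⋆ₐ[ℂ] A.toStarSubalgebra) (C : Context A) :
    ProjComplete (C.imageSet h) := by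
  intro S hS
  let S' : Set (Proj C.toVN) := {q | (Proj.map h (C.projIncl q)).1 ∈ S}
  obtain ⟨g, hg⟩ := exists_isGLB_proj C.toVN S'
  have h1 : IsGLB (Proj.mapIso h '' (C.projIncl '' S')) (Proj.mapIso h (C.projIncl g)) :=
    (OrderIso.isGLB_image' _).mpr (C.isGLB_projIncl hg)
  refine ⟨_, C.map_projIncl_mem h g, (Proj.map h (C.projIncl g)).2.2, fun x => ?_⟩
  refine (h1.apply_eq_self_iff x).trans ⟨fun hx p hp => ?_, ?_⟩
  · obtain ⟨q, rfl⟩ := C.exists_map_projIncl h (hS hp).1 (hS hp).2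
    exact hx _ ⟨_, ⟨q, hp, rfl⟩, rfl⟩
  · rintro hx _ ⟨_, ⟨q, hq, rfl⟩, rfl⟩
    exact hx _ hq

/-- The approximation holds in the von Neumann algebra `C`, and `h` restricted to `C` is isometric
and maps projections to projections. -/
theorem star_mul_self_mem_closure_projCone (h : A.toStarSubalgebra ≃⋆ₐ[ℂ] A.toStarSubalgebra)
    (C : Context A) {b : H →L[ℂ] H} (hb : b ∈ C.imageSet h) :
    star b * b ∈ closure (projCone (C.imageSet h) : Set (H →L[ℂ] H)) := by
  obtain ⟨c, rfl⟩ := hb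
  have hc : ((star c * c : C.alg) : H →L[ℂ] H) ∈
      closure (projCone (C.toVN : Set (H →L[ℂ] H)) : Set (H →L[ℂ] H)) :=
    C.toVN.mem_closure_projCone (star c * c).2 (star_mul_self_nonneg (c : H →L[ℂ] H))
  have heq : star (C.imageHom h c) * C.imageHom h c = C.imageHom h (star c * c) := by
    rw [map_mul, map_star]
  change star (C.imageHom h c) * C.imageHom h c ∈ _
  rw [heq]
  have hmap : ∀ v ∈ projCone (C.toVN : Set (H →L[ℂ] H)), ∃ hv : v ∈ C.alg,
      C.imageHom h ⟨v, hv⟩ ∈ projCone (C.imageSet h) := by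
    intro v hv
    induction hv using Submodule.span_induction with
    | mem r hr =>
      exact ⟨hr.1, Submodule.subset_span ⟨⟨⟨r, hr.1⟩, rfl⟩,
        (Proj.map h (C.projIncl ⟨r, hr.1, hr.2⟩)).2.2⟩⟩
    | zero =>
      refine ⟨zero_mem _, ?_⟩
      have : C.imageHom h ⟨0, zero_mem _⟩ = 0 := map_zero (C.imageHom h)
      rw [this]
      exact zero_mem _
    | add S T _ _ hS hT =>
      obtain ⟨hS, hS'⟩ := hS
      obtain ⟨hT, hT'⟩ := hT
      refine ⟨add_mem hS hT, ?_⟩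
      have : C.imageHom h ⟨S + T, add_mem hS hT⟩ = C.imageHom h ⟨S, hS⟩ + C.imageHom h ⟨T, hT⟩ :=
        map_add (C.imageHom h) ⟨S, hS⟩ ⟨T, hT⟩
      rw [this]
      exact add_mem hS' hT'
    | smul k T _ hT =>
      obtain ⟨hT, hT'⟩ := hT
      refine ⟨C.alg.smul_mem hT ((k : ℝ) : ℂ), ?_⟩
      have : C.imageHom h ⟨k • T, C.alg.smul_mem hT ((k : ℝ) : ℂ)⟩ = k • C.imageHom h ⟨T, hT⟩ :=
        map_smul (C.imageHom h) ((k : ℝ) : ℂ) ⟨T, hT⟩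
      rw [this]
      exact Submodule.smul_mem _ k hT'
  rw [Metric.mem_closure_iff] at hc ⊢
  intro ε hε
  obtain ⟨v, hv, hd⟩ := hc ε hε
  obtain ⟨hvC, hv'⟩ := hmap v hv
  refine ⟨_, hv', ?_⟩
  rw [(C.isometry_imageHom h).dist_eq]
  exact hd

/-- The image of a context under a `*`-automorphism is a von Neumann algebra. -/
theorem coe_image_eq_imageSet (h : A.toStarSubalgebra ≃⋆ₐ[ℂ] A.toStarSubalgebra) (C : Context A) :
    ((image h C).toVN : Set (H →L[ℂ] H)) = C.imageSet h := by
  refine subset_antisymm ?_ ?_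
  -- An isometric image of a complete algebra is norm closed, so it suffices to find the projections
  -- of the bicommutant in `h[C]`.
  · have hcl : IsClosed ((C.imageHom h).range : Set (H →L[ℂ] H)) :=
      (C.isometry_imageHom h).isClosedEmbedding.isClosed_range
    rw [← coe_range_imageHom]
    refine (image h C).toVN.subset_of_projections hcl fun p hp hps => ?_
    refine projection_mem_of_bicommutant (B := (C.imageHom h).range) (C.comm_imageSet h)
      (fun b hb => C.star_mul_self_mem_closure_projCone h hb) (C.projComplete_imageSet h) hps ?_
    change p ∈ ((image h C).toVN : Set (H →L[ℂ] H)) at hp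
    rwa [coe_image] at hp
  · rw [coe_image]
    exact Set.subset_centralizer_centralizer

/-- Applied to `h` and to its inverse, this makes the monotone map `image h` an order automorphism
of the contexts. It depends on `h[C]` being its own bicommutant. -/
theorem image_image_symm (h : A.toStarSubalgebra ≃⋆ₐ[ℂ] A.toStarSubalgebra) (C : Context A) :
    image h (image h.symm C) = C := by
  have hset : ((image h (image h.symm C)).toVN : Set (H →L[ℂ] H)) = C.toVN := by
    rw [coe_image_eq_imageSet]
    ext x
    constructor
    · rintro ⟨⟨c, hc⟩, rfl⟩
      have hc' : c ∈ ((image h.symm C).toVN : Set (H →L[ℂ] H)) := hc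
      rw [coe_image_eq_imageSet] at hc'
      obtain ⟨d, rfl⟩ := hc'
      have : h (h.symm (C.inclA d)) = C.inclA d := h.apply_symm_apply _
      exact (congrArg Subtype.val this ▸ d.2 : (h (h.symm (C.inclA d)) : H →L[ℂ] H) ∈ C.toVN)
    · intro hx
      have hc : (h.symm (C.inclA ⟨x, hx⟩) : H →L[ℂ] H) ∈
          ((image h.symm C).toVN : Set (H →L[ℂ] H)) := by
        rw [coe_image_eq_imageSet]
        exact ⟨⟨x, hx⟩, rfl⟩
      exact ⟨⟨_, hc⟩, congrArg Subtype.val (h.apply_symm_apply (C.inclA ⟨x, hx⟩))⟩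
  have : (image h (image h.symm C)).toVN = C.toVN := SetLike.coe_injective hset
  exact le_antisymm this.le this.ge

theorem image_symm_image (h : A.toStarSubalgebra ≃⋆ₐ[ℂ] A.toStarSubalgebra) (C : Context A) :
    image h.symm (image h C) = C :=
  image_image_symm h.symm C

end Context

end ImageContext

/-! ### Spectral projections as support projections -/

theorem ContinuousLinearMap.ext_of_inner_self {H : Type u} [NormedAddCommGroup H]
    [InnerProductSpace ℂ H] {S T : H →L[ℂ] H}
    (h : ∀ x, ⟪x, S x⟫_ℂ = ⟪x, T x⟫_ℂ) : S = T := by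
  apply ContinuousLinearMap.coe_injective
  rw [← ext_inner_map]
  intro x
  have := congrArg (starRingEnd ℂ) (h x)
  rwa [inner_conj_symm, inner_conj_symm] at this

section SpectralProjectionLaws
variable {H : Type u} [NormedAddCommGroup H] [InnerProductSpace ℂ H] [CompleteSpace H]

theorem apply_eq_zero_of_inner_self {T : H →L[ℂ] H} (hT : 0 ≤ T) {x : H}
    (hx : ⟪x, T x⟫_ℂ = 0) : T x = 0 := by
  obtain ⟨s, rfl⟩ := CStarAlgebra.nonneg_iff_eq_star_mul_self.mp hT
  have h1 : ⟪x, (star s * s) x⟫_ℂ = ⟪s x, s x⟫_ℂ := by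
    change ⟪x, (star s) (s x)⟫_ℂ = _
    rw [ContinuousLinearMap.star_eq_adjoint, ContinuousLinearMap.adjoint_inner_right]
  rw [h1, inner_self_eq_zero] at hx
  change (star s) (s x) = 0
  rw [hx, map_zero]

/-- A self-adjoint operator with the kernel of a projection, and the identity on its range, is
the projection. -/
theorem IsStarProjection.eq_of_selfAdjoint {e E : H →L[ℂ] H} (he : IsStarProjection e)
    (hE : IsSelfAdjoint E) (h1 : ∀ x, e x = 0 → E x = 0) (h2 : ∀ x, e ((1 - E) x) = 0) :
    E = e := by
  have h3 : E * e = E := mul_eq_self_of_ker he h1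
  have h4 : e * (1 - E) = 0 := by ext x; exact h2 x
  have h5 : e * E = e := by rw [mul_sub, mul_one, sub_eq_zero] at h4; exact h4.symm
  have h6 := congrArg star h3
  rw [star_mul, he.isSelfAdjoint.star_eq, hE.star_eq, h5] at h6
  exact h6.symm

/-- No mass is lost: a compactly supported function that equals 1 on the compact spectrum of `a`
acts as the identity operator. -/
theorem vectorSpectralMeasure_real_univ {a : H →L[ℂ] H} (ha : IsSelfAdjoint a) (x : H) :
    (vectorSpectralMeasure a x).real Set.univ = ‖x‖ ^ 2 := by
  refine le_antisymm ?_ ?_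
  · exact ENNReal.toReal_le_of_le_ofReal (by positivity) (vectorSpectralMeasure_univ_le a x)
  · have hK : IsCompact (spectrum ℝ a) := ContinuousFunctionalCalculus.isCompact_spectrum a
    obtain ⟨f, hf1, hf2, -, hf3⟩ :=
      exists_continuousMap_one_of_isCompact_subset_isOpen hK isOpen_univ (Set.subset_univ _)
    let g : C_c(ℝ, ℝ) := ⟨f, hasCompactSupport_def.mpr hf2⟩
    have h1 := integral_vectorSpectralMeasure a x g
    have h2 : cfc (g : ℝ → ℝ) a = 1 := by
      rw [← cfc_const_one ℝ a]
      exact cfc_congr hf1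
    have h3 : (⟪x, x⟫_ℂ).re = ‖x‖ ^ 2 := inner_self_eq_norm_sq (𝕜 := ℂ) x
    rw [h2, one_apply_eq_self, h3] at h1
    rw [← h1]
    calc ∫ t, g t ∂(vectorSpectralMeasure a x) ≤ ∫ _, (1 : ℝ) ∂(vectorSpectralMeasure a x) :=
          integral_mono g.integrable (integrable_const 1) fun t => (hf3 t).2
      _ = _ := by simp

theorem spectralProjection_univ {a : H →L[ℂ] H} (ha : IsSelfAdjoint a) :
    spectralProjection a Set.univ = 1 := by
  refine ContinuousLinearMap.ext_of_inner_self fun x => ?_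
  rw [inner_spectralProjection, vectorSpectralMeasure_real_univ ha, one_apply_eq_self,
    inner_self_eq_norm_sq_to_K]
  simp

theorem spectralProjection_empty (a : H →L[ℂ] H) : spectralProjection a ∅ = 0 := by
  refine ContinuousLinearMap.ext_of_inner_self fun x => ?_
  rw [inner_spectralProjection]
  simp

theorem spectralProjection_compl {a : H →L[ℂ] H} (ha : IsSelfAdjoint a) {Δ : Set ℝ}
    (hΔ : MeasurableSet Δ) : spectralProjection a Δᶜ = 1 - spectralProjection a Δ := by
  refine ContinuousLinearMap.ext_of_inner_self fun x => ?_
  rw [sub_apply, inner_sub_right, ← spectralProjection_univ ha]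
  simp only [inner_spectralProjection]
  rw [measureReal_compl hΔ]
  push_cast
  rfl

theorem spectralProjection_nonneg (a : H →L[ℂ] H) (Δ : Set ℝ) : 0 ≤ spectralProjection a Δ := by
  rw [ContinuousLinearMap.nonneg_iff_isPositive, ContinuousLinearMap.isPositive_iff_complex]
  intro x
  have h : ⟪spectralProjection a Δ x, x⟫_ℂ = ((vectorSpectralMeasure a x).real Δ : ℂ) := by
    rw [← inner_conj_symm, inner_spectralProjection, Complex.conj_ofReal]
  rw [h]
  exact ⟨rfl, measureReal_nonneg⟩

/-- The operator `χ_Δ(a)` is given by its quadratic form, and idempotence is not yet available;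
positivity is enough to turn a null set into a vanishing vector. -/
theorem spectralProjection_apply_eq_zero {a : H →L[ℂ] H} {Δ : Set ℝ} {x : H}
    (h : vectorSpectralMeasure a x Δ = 0) : spectralProjection a Δ x = 0 := by
  refine apply_eq_zero_of_inner_self (spectralProjection_nonneg a Δ) ?_
  rw [inner_spectralProjection, measureReal_def, h]
  simp

theorem spectralProjection_apply_eq_self {a : H →L[ℂ] H} (ha : IsSelfAdjoint a) {Δ : Set ℝ}
    (hΔ : MeasurableSet Δ) {x : H} (h : vectorSpectralMeasure a x Δᶜ = 0) :
    (1 - spectralProjection a Δ) x = 0 := by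
  rw [← spectralProjection_compl ha hΔ]
  exact spectralProjection_apply_eq_zero h

/-- The spectral measure at `f(a) y` has density `f²` with respect to the one at `y`. -/
theorem vectorSpectralMeasure_cfc_apply (a : H →L[ℂ] H) (f : C_c(ℝ, ℝ))
    (y : H) : vectorSpectralMeasure a (cfc (f : ℝ → ℝ) a y) =
      (vectorSpectralMeasure a y).withDensity fun t => ((f t ^ 2).toNNReal : ENNReal) := by
  have hm : Measurable fun t => (f t ^ 2).toNNReal :=
    (f.continuous.pow 2).measurable.real_toNNReal
  have hint : Integrable (fun t => f t ^ 2) (vectorSpectralMeasure a y) := by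
    have : (fun t => f t ^ 2) = fun t => (f * f) t := by ext t; simp [sq]
    rw [this]
    exact (f * f).integrable
  have : IsFiniteMeasure ((vectorSpectralMeasure a y).withDensity
      fun t => ((f t ^ 2).toNNReal : ENNReal)) :=
    isFiniteMeasure_withDensity_ofReal hint.2
  refine Measure.ext_of_integral_eq_on_compactlySupported fun g => ?_
  rw [integral_withDensity_eq_integral_smul hm, integral_vectorSpectralMeasure]
  -- Both measures integrate `g` to `⟪y, (f g f)(a) y⟫`, after moving one factor `f(a)` across the
  -- inner product.
  have h1 := integral_vectorSpectralMeasure a y (f * g * f)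
  have h2 : cfc ((f * g * f : C_c(ℝ, ℝ)) : ℝ → ℝ) a =
      cfc (f : ℝ → ℝ) a * cfc (g : ℝ → ℝ) a * cfc (f : ℝ → ℝ) a := by
    have h3 : ((f * g * f : C_c(ℝ, ℝ)) : ℝ → ℝ) = fun t => f t * g t * f t := by ext t; simp
    rw [h3, cfc_mul (fun t => f t * g t) f a
      (f.continuous.mul g.continuous).continuousOn f.continuous.continuousOn,
      cfc_mul f g a f.continuous.continuousOn g.continuous.continuousOn]
  have hsa : IsSelfAdjoint (cfc (f : ℝ → ℝ) a) := cfc_predicate _ a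
  have h4 : ⟪cfc (f : ℝ → ℝ) a y, cfc (g : ℝ → ℝ) a (cfc (f : ℝ → ℝ) a y)⟫_ℂ =
      ⟪y, cfc (f : ℝ → ℝ) a (cfc (g : ℝ → ℝ) a (cfc (f : ℝ → ℝ) a y))⟫_ℂ := by
    rw [← ContinuousLinearMap.adjoint_inner_right, ← ContinuousLinearMap.star_eq_adjoint,
      hsa.star_eq]
  rw [h4]
  rw [h2] at h1
  refine h1.symm.trans (integral_congr_ae (.of_forall fun t => ?_))
  change f t * g t * f t = (f t ^ 2).toNNReal • g t
  rw [NNReal.smul_def, Real.coe_toNNReal _ (sq_nonneg _), smul_eq_mul]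
  ring

/-- The spectral projection of `{f ≠ 0}` is the support projection of `f(a)`. -/
theorem spectralProjection_support {a : H →L[ℂ] H} (ha : IsSelfAdjoint a) (f : C_c(ℝ, ℝ))
    (hf : ∀ t, 0 ≤ f t) {e : H →L[ℂ] H} (he : IsStarProjection e)
    (hker : ∀ x, e x = 0 ↔ cfc (f : ℝ → ℝ) a x = 0) :
    spectralProjection a {t | f t ≠ 0} = e := by
  have hΔ : MeasurableSet {t | f t ≠ 0} :=
    (isOpen_ne.preimage f.continuous).measurableSet
  refine he.eq_of_selfAdjoint (IsSelfAdjoint.of_nonneg (spectralProjection_nonneg a _))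
    (fun x hx => ?_) fun x => ?_
  · apply spectralProjection_apply_eq_zero
    -- If `f(a) x = 0`, then `f` has integral zero for the spectral measure at `x`, so `{f ≠ 0}` is
    -- a null set.
    have h1 := integral_vectorSpectralMeasure a x f
    rw [(hker x).mp hx, inner_zero_right, Complex.zero_re,
      integral_eq_zero_iff_of_nonneg hf f.integrable] at h1
    exact h1
  · rw [hker]
    -- By its density `f²`, the spectral measure at `f(a) y` does not charge `{f = 0}`, so the
    -- spectral projection fixes the range of `f(a)`. Taking adjoints gives `f(a) (1 - E) = 0`.
    have h2 : (1 - spectralProjection a {t | f t ≠ 0}) * cfc (f : ℝ → ℝ) a = 0 := by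
      ext y
      refine spectralProjection_apply_eq_self ha hΔ ?_
      change vectorSpectralMeasure a (cfc (f : ℝ → ℝ) a y) _ = 0
      rw [vectorSpectralMeasure_cfc_apply, withDensity_apply _ hΔ.compl,
        setLIntegral_congr_fun (g := fun _ => 0) hΔ.compl]
      · simp
      · intro t ht
        have : f t = 0 := by simpa using ht
        simp [this]
    have h3 := congrArg star h2
    have hsa : IsSelfAdjoint (cfc (f : ℝ → ℝ) a) := cfc_predicate _ a
    have hsE : IsSelfAdjoint (1 - spectralProjection a {t | f t ≠ 0}) :=
      (IsSelfAdjoint.one _).sub (IsSelfAdjoint.of_nonneg (spectralProjection_nonneg a _))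
    rw [star_mul, hsa.star_eq, hsE.star_eq, star_zero] at h3
    exact congrArg (fun T : H →L[ℂ] H => T x) h3

/-- The supremum of a set of projections kills exactly the vectors that all of them kill. -/
theorem IsLUB.apply_eq_zero_iff {C : VonNeumannAlgebra H} {S : Set (Proj C)} {g : Proj C}
    (hg : IsLUB S g) (x : H) : g.1 x = 0 ↔ ∀ q ∈ S, q.1 x = 0 := by
  constructor
  · intro hx q hq
    have : q.1 * g.1 = q.1 := (q.2.2.le_iff_mul_eq_left g.2.2).mp (hg.1 hq)
    have := congrArg (fun T : H →L[ℂ] H => T x) this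
    change q.1 (g.1 x) = q.1 x at this
    rw [← this, hx, map_zero]
  · intro hx
    -- The complement of the projection onto the line of `x` is an upper bound of `S` among all
    -- projections on `H`.
    let r : H →L[ℂ] H := (ℂ ∙ x).starProjection
    have hr : IsStarProjection r := isStarProjection_starProjection
    have hrx : r x = x :=
      Submodule.starProjection_eq_self_iff.mpr (Submodule.mem_span_singleton_self x)
    have hle : g.1 ≤ 1 - r := hg.le_of_proj hr.one_sub fun q hq => by
      refine q.2.2.le_of_mul_eq_left hr.one_sub (mul_eq_self_of_ker hr.one_sub fun y hy => ?_)
      obtain ⟨c, rfl⟩ := Submodule.mem_span_singleton.mp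
        (Submodule.starProjection_eq_self_iff.mp (sub_eq_zero.mp hy).symm)
      rw [map_smul, hx q hq, smul_zero]
    have := (g.2.2.le_iff_mul_eq_left hr.one_sub).mp hle
    have := congrArg (fun T : H →L[ℂ] H => T x) this
    change g.1 (x - r x) = g.1 x at this
    rw [← this, hrx, sub_self, map_zero]

/-- Spectral projections are `σ`-additive. -/
theorem spectralProjection_iUnion {A : VonNeumannAlgebra H} {a : H →L[ℂ] H}
    (ha : IsSelfAdjoint a) {Δ : ℕ → Set ℝ} (hΔ : ∀ i, MeasurableSet (Δ i)) (p : ℕ → Proj A)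
    (hp : ∀ i, spectralProjection a (Δ i) = (p i).1) {P : Proj A} (hP : IsLUB (Set.range p) P) :
    spectralProjection a (⋃ i, Δ i) = P.1 := by
  have hU : MeasurableSet (⋃ i, Δ i) := .iUnion hΔ
  have hsE := IsSelfAdjoint.of_nonneg (spectralProjection_nonneg a (⋃ i, Δ i))
  have hzero : ∀ i x, (p i).1 x = 0 → vectorSpectralMeasure a x (Δ i) = 0 := by
    intro i x hx
    have := inner_spectralProjection a (Δ i) x
    rw [hp, hx, inner_zero_right, eq_comm, Complex.ofReal_eq_zero, measureReal_eq_zero_iff] at this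
    exact this
  refine P.2.2.eq_of_selfAdjoint hsE (fun x hx => ?_) fun x => ?_
  · refine spectralProjection_apply_eq_zero (measure_iUnion_null fun i => hzero i x ?_)
    exact (hP.apply_eq_zero_iff x).mp hx _ ⟨i, rfl⟩
  · rw [hP.apply_eq_zero_iff]
    rintro _ ⟨i, rfl⟩
    -- The spectral measure at `p i y` is concentrated on `Δ i`, hence on the union.
    have h2 : (1 - spectralProjection a (⋃ i, Δ i)) * (p i).1 = 0 := by
      ext y
      refine spectralProjection_apply_eq_self ha hU ?_
      refine measure_mono_null (Set.compl_subset_compl.mpr (Set.subset_iUnion Δ i)) ?_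
      have h3 := inner_spectralProjection a (Δ i)ᶜ ((p i).1 y)
      rw [spectralProjection_compl ha (hΔ i), hp, sub_apply, one_apply_eq_self,
        (p i).2.2.apply_apply, sub_self, inner_zero_right, eq_comm, Complex.ofReal_eq_zero,
        measureReal_eq_zero_iff] at h3
      exact h3
    have h3 := congrArg star h2
    rw [star_mul, (p i).2.2.isSelfAdjoint.star_eq, ((IsSelfAdjoint.one _).sub hsE).star_eq,
      star_zero] at h3
    exact congrArg (fun T : H →L[ℂ] H => T x) h3

end SpectralProjectionLaws

/-! ### Automorphisms and spectral projections -/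

section SpectralProjectionAutomorphism
variable {H : Type u} [NormedAddCommGroup H] [InnerProductSpace ℂ H] [CompleteSpace H]
variable {A : VonNeumannAlgebra H}

/-- Injective `*`-homomorphisms of C*-algebras are isometric, so `h` is norm continuous and commutes
with the functional calculus. As `A` is closed, the calculus may be computed in `A` or among all
operators. -/
theorem StarAlgEquiv.coe_apply_cfc (h : A.toStarSubalgebra ≃⋆ₐ[ℂ] A.toStarSubalgebra)
    {a : A.toStarSubalgebra} (ha : IsSelfAdjoint a) {f : ℝ → ℝ} (hf : Continuous f)
    (hmem : cfc f (a : H →L[ℂ] H) ∈ A.toStarSubalgebra) :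
    (h ⟨cfc f (a : H →L[ℂ] H), hmem⟩ : H →L[ℂ] H) = cfc f (h a : H →L[ℂ] H) := by
  have : IsClosed (A.toStarSubalgebra : Set (H →L[ℂ] H)) := A.isClosed_coe
  have hcoe : ∀ b : A.toStarSubalgebra, IsSelfAdjoint b →
      ((cfc f b : A.toStarSubalgebra) : H →L[ℂ] H) = cfc f (b : H →L[ℂ] H) := fun b hb =>
    StarAlgHom.map_cfc A.toStarSubalgebra.subtype f b hf.continuousOn continuous_subtype_val hb
      (hb.map A.toStarSubalgebra.subtype)
  have h1 : (⟨cfc f (a : H →L[ℂ] H), hmem⟩ : A.toStarSubalgebra) = cfc f a :=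
    Subtype.ext (hcoe a ha).symm
  have h2 : h (cfc f a) = cfc f (h a) :=
    StarAlgHomClass.map_cfc h f a hf.continuousOn
      (NonUnitalStarAlgHom.isometry h h.injective).continuous ha (ha.map h)
  rw [h1, h2, hcoe _ (ha.map h)]

/-- The inclusion of kernels amounts to the algebraic identity `b e = b`, which `h` preserves. -/
theorem Proj.map_apply_eq_zero_of_support (h : A.toStarSubalgebra ≃⋆ₐ[ℂ] A.toStarSubalgebra)
    {b : A.toStarSubalgebra} {e : Proj A}
    (he : ∀ x, e.1 x = 0 → (b : H →L[ℂ] H) x = 0) :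
    ∀ x, (Proj.map h e).1 x = 0 → (h b : H →L[ℂ] H) x = 0 := by
  intro x hx
  have h1 : b * ⟨e.1, e.2.1⟩ = b := Subtype.ext (mul_eq_self_of_ker e.2.2 he)
  have h2 : h b * h ⟨e.1, e.2.1⟩ = h b := by rw [← map_mul, h1]
  have h3 := congrArg (fun T : A.toStarSubalgebra => (T : H →L[ℂ] H) x) h2
  change (h b : H →L[ℂ] H) ((Proj.map h e).1 x) = (h b : H →L[ℂ] H) x at h3
  rw [← h3, hx, map_zero]

/-- Automorphisms preserve support projections. -/
theorem Proj.map_support (h : A.toStarSubalgebra ≃⋆ₐ[ℂ] A.toStarSubalgebra)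
    {b : A.toStarSubalgebra} {e : Proj A} (he : ∀ x, e.1 x = 0 ↔ (b : H →L[ℂ] H) x = 0) (x : H) :
    (Proj.map h e).1 x = 0 ↔ (h b : H →L[ℂ] H) x = 0 := by
  refine ⟨Proj.map_apply_eq_zero_of_support h (fun x => (he x).mp) x, fun hx => ?_⟩
  -- For the converse, the support `s` of `h b`, pulled back by `h⁻¹`, lies above the support `e` of
  -- `b`; hence `h(e) ≤ s`.
  obtain ⟨s, hsA, hs, hsker⟩ := A.exists_support (h b).2
  let s' : Proj A := ⟨s, hsA, hs⟩
  have h1 : ∀ x, (Proj.map h.symm s').1 x = 0 → (b : H →L[ℂ] H) x = 0 := by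
    have := Proj.map_apply_eq_zero_of_support h.symm (b := h b) (e := s') fun x => (hsker x).mp
    rwa [h.symm_apply_apply] at this
  have h2 : e ≤ Proj.map h.symm s' :=
    e.2.2.le_of_mul_eq_left (Proj.map h.symm s').2.2
      (mul_eq_self_of_ker (Proj.map h.symm s').2.2 fun x hx => (he x).mpr (h1 x hx))
  have h3 := Proj.map_mono h h2
  rw [Proj.map_map_symm] at h3
  have h4 : (Proj.map h e).1 * s = (Proj.map h e).1 :=
    ((Proj.map h e).2.2.le_iff_mul_eq_left hs).mp h3
  rw [← h4]
  change (Proj.map h e).1 (s x) = 0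
  rw [(hsker x).mpr hx, map_zero]

/-- The spectral projections of a self-adjoint element of `A` are projections of `A`, and
`h(χ_Δ(a)) = χ_Δ(h(a))` for every `*`-automorphism `h` of `A`. -/
theorem exists_proj_spectralProjection (h : A.toStarSubalgebra ≃⋆ₐ[ℂ] A.toStarSubalgebra)
    {a : A.toStarSubalgebra} (ha : IsSelfAdjoint a) {Δ : Set ℝ} (hΔ : MeasurableSet Δ) :
    ∃ p : Proj A, spectralProjection (a : H →L[ℂ] H) Δ = p.1 ∧
      spectralProjection (h a : H →L[ℂ] H) Δ = (Proj.map h p).1 := by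
  have ha' : IsSelfAdjoint (a : H →L[ℂ] H) := ha.map A.toStarSubalgebra.subtype
  have hha : IsSelfAdjoint (h a : H →L[ℂ] H) := (ha.map h).map A.toStarSubalgebra.subtype
  have hcl : IsClosed (A.toStarSubalgebra : Set (H →L[ℂ] H)) := A.isClosed_coe
  induction Δ, hΔ using MeasurableSpace.induction_on_inter
    (BorelSpace.measurable_eq.trans Real.borel_eq_generateFrom_Ioo_rat)
    Real.isPiSystem_Ioo_rat with
  | empty =>
    refine ⟨⟨0, zero_mem A, .zero _⟩, spectralProjection_empty _, ?_⟩
    rw [spectralProjection_empty]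
    exact (congrArg (fun z : A.toStarSubalgebra => (z : H →L[ℂ] H)) (map_zero h)).symm
  | basic Δ hΔ =>
    simp only [Set.mem_iUnion, Set.mem_singleton_iff] at hΔ
    obtain ⟨l, u, -, rfl⟩ := hΔ
    -- A tent function that is nonzero exactly on the interval, so that the spectral projection of
    -- the interval is the support of `f(a)`.
    let f₀ : ℝ → ℝ := fun t => max 0 (min (t - l) (u - t))
    have hf₀ : Continuous f₀ := by fun_prop
    have hsupp : ∀ t, f₀ t ≠ 0 ↔ t ∈ Set.Ioo (l : ℝ) u := by
      intro t
      simp only [f₀, Set.mem_Ioo, ne_eq, max_eq_left_iff, not_le, lt_min_iff, sub_pos]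
    let f : C_c(ℝ, ℝ) := ⟨⟨f₀, hf₀⟩,
      HasCompactSupport.intro (isCompact_Icc (a := (l : ℝ)) (b := u)) fun t ht => by
        by_contra hne
        exact ht (Set.Ioo_subset_Icc_self ((hsupp t).mp hne))⟩
    have hset : Set.Ioo (l : ℝ) u = {t | f t ≠ 0} := Set.ext fun t => (hsupp t).symm
    have hmem : cfc (f : ℝ → ℝ) (a : H →L[ℂ] H) ∈ A.toStarSubalgebra := cfc_mem (𝕜' := ℂ) _ a.2
    obtain ⟨e, heA, he, hker⟩ := A.exists_support hmem
    refine ⟨⟨e, heA, he⟩, ?_, ?_⟩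
    · rw [hset]
      exact spectralProjection_support ha' f (fun t => le_max_left _ _) he hker
    · rw [hset]
      refine spectralProjection_support hha f (fun t => le_max_left _ _) (Proj.map h _).2.2 ?_
      intro x
      rw [Proj.map_support h (b := ⟨_, hmem⟩) hker x, h.coe_apply_cfc ha (f := f) f.continuous hmem]
  | compl Δ hΔ ih =>
    obtain ⟨p, hp, hhp⟩ := ih
    refine ⟨⟨1 - p.1, sub_mem (one_mem A) p.2.1, p.2.2.one_sub⟩, ?_, ?_⟩
    · rw [spectralProjection_compl ha' hΔ, hp]
    · rw [spectralProjection_compl hha hΔ, hhp]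
      have : h (1 - ⟨p.1, p.2.1⟩) = 1 - h ⟨p.1, p.2.1⟩ := by rw [map_sub, map_one]
      exact (congrArg (fun z : A.toStarSubalgebra => (z : H →L[ℂ] H)) this).symm
  | iUnion Δ _ hΔ ih =>
    choose p hp hhp using ih
    -- Countable unions become suprema in the projection lattice of `A`, which `h` preserves as an
    -- order automorphism.
    obtain ⟨P, hP⟩ := exists_isLUB_proj A (Set.range p)
    refine ⟨P, spectralProjection_iUnion ha' hΔ p hp hP, ?_⟩
    refine spectralProjection_iUnion hha hΔ (fun i => Proj.map h (p i)) hhp ?_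
    have := (OrderIso.isLUB_image' (Proj.mapIso h)).mpr hP
    rwa [← Set.range_comp] at this

end SpectralProjectionAutomorphism

/-! ### Automorphisms and daseinisation -/

section Daseinisation
variable {H : Type u} [NormedAddCommGroup H] [InnerProductSpace ℂ H] [CompleteSpace H]
variable {A : VonNeumannAlgebra H}

namespace Context

theorem mem_image_iff (h : A.toStarSubalgebra ≃⋆ₐ[ℂ] A.toStarSubalgebra) (C : Context A)
    {x : H →L[ℂ] H} : x ∈ (image h C).toVN ↔ x ∈ C.imageSet h := by
  rw [← coe_image_eq_imageSet]
  exact Iff.rfl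

/-- The isomorphism between the projections of `C` and of `h[C]`. -/
noncomputable def projImage (h : A.toStarSubalgebra ≃⋆ₐ[ℂ] A.toStarSubalgebra) (C : Context A) :
    Proj C.toVN ≃o Proj (image h C).toVN :=
  let F : Proj C.toVN → Proj (image h C).toVN := fun q =>
    ⟨(Proj.map h (C.projIncl q)).1, (mem_image_iff h C).mpr (C.map_projIncl_mem h q),
      (Proj.map h (C.projIncl q)).2.2⟩
  have hle : ∀ q r, F q ≤ F r ↔ q ≤ r := fun q r =>
    (Proj.mapIso h).le_iff_le (x := C.projIncl q) (y := C.projIncl r)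
  { Equiv.ofBijective F
      ⟨fun q r hqr => le_antisymm ((hle q r).mp hqr.le) ((hle r q).mp hqr.ge), fun p => by
        obtain ⟨q, hq⟩ := C.exists_map_projIncl h ((mem_image_iff h C).mp p.2.1) p.2.2
        exact ⟨q, Subtype.ext hq⟩⟩ with
    map_rel_iff' := fun {q r} => hle q r }

/-- The projection `p` need not lie in `C`: comparison with `p` takes place in `A`, where `h` is an
order automorphism. So `projImage` carries the projections of `C` above `p` onto those of `h[C]`
above `h(p)`, and it preserves infima. -/
theorem map_outerDas (h : A.toStarSubalgebra ≃⋆ₐ[ℂ] A.toStarSubalgebra) (C : Context A)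
    (p : Proj A) :
    C.projImage h (outerDas C.toVN p.1) = outerDas (image h C).toVN (Proj.map h p).1 := by
  refine ((C.projImage h).isGLB_image'.mpr (isGLB_outerDas C.toVN p.1)).unique ?_
  have : C.projImage h '' {q | p.1 ≤ q.1} = {q | (Proj.map h p).1 ≤ q.1} := by
    rw [(C.projImage h).image_eq_preimage_symm]
    ext q
    obtain ⟨q, rfl⟩ := (C.projImage h).surjective q
    rw [Set.mem_preimage, OrderIso.symm_apply_apply]
    exact ((Proj.mapIso h).le_iff_le (x := p) (y := C.projIncl q)).symm
  rw [this]
  exact isGLB_outerDas _ _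

theorem map_innerDas (h : A.toStarSubalgebra ≃⋆ₐ[ℂ] A.toStarSubalgebra) (C : Context A)
    (p : Proj A) :
    C.projImage h (innerDas C.toVN p.1) = innerDas (image h C).toVN (Proj.map h p).1 := by
  refine ((C.projImage h).isLUB_image'.mpr (isLUB_innerDas C.toVN p.1)).unique ?_
  have : C.projImage h '' {q | q.1 ≤ p.1} = {q | q.1 ≤ (Proj.map h p).1} := by
    rw [(C.projImage h).image_eq_preimage_symm]
    ext q
    obtain ⟨q, rfl⟩ := (C.projImage h).surjective q
    rw [Set.mem_preimage, OrderIso.symm_apply_apply]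
    exact ((Proj.mapIso h).le_iff_le (x := C.projIncl q) (y := p)).symm
  rw [this]
  exact isLUB_innerDas _ _

/-- The basic open set `{λ | λ(q) = 1}` of the Gelfand spectrum. -/
def specOpen (C : Context A) (q : Proj C.toVN) : Opens C.Spec :=
  ⟨C.specSet q, C.isOpen_specSet q⟩

end Context

/-! ### Forcing and truth values in the two models -/

open Context

theorem Contravariant.forces_elementary_iff (ψ : State A) (a : A.toStarSubalgebra) (Δ : Set ℝ)
    (C : Context A) :
    Forces C (elementary a Δ ≫ valuation ψ OrderHom.id) (lowerOne A) ↔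
      ∀ D ≤ C, ψ.localValuation D
        (D.specOpen (outerDas D.toVN (spectralProjection (a : H →L[ℂ] H) Δ))) = 1 :=
  Subtype.ext_iff.trans (funext_iff.trans Subtype.forall)

/-- The preimage of `{λ | λ(q) = 1}` under `λ ↦ λ ∘ h|_D` is by definition `{λ | λ(h(q)) = 1}`;
equality with the constant 1 is then tested at each `D ≤ C`. -/
theorem Contravariant.forces_invImage_iff (h : A.toStarSubalgebra ≃⋆ₐ[ℂ] A.toStarSubalgebra)
    (ψ : State A) (a : A.toStarSubalgebra) (Δ : Set ℝ) (C : Context A) :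
    Forces C (elementary a Δ ≫ invImage h ≫ valuation ψ (image h)) (lowerOne A) ↔
      ∀ D ≤ C, ψ.localValuation (image h D) ((image h D).specOpen
        (D.projImage h (outerDas D.toVN (spectralProjection (a : H →L[ℂ] H) Δ)))) = 1 :=
  Subtype.ext_iff.trans (funext_iff.trans Subtype.forall)

theorem Covariant.forces_elementary_iff (ψ : State A) (a : A.toStarSubalgebra) (Δ : Set ℝ)
    (C : Context A) :
    Forces C (elementary a Δ ≫ valuation ψ OrderHom.id) (lowerOne A) ↔
      ∀ D ≥ C, ψ.localValuation D
        (D.specOpen (innerDas D.toVN (spectralProjection (a : H →L[ℂ] H) Δ))) = 1 :=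
  Subtype.ext_iff.trans (funext_iff.trans Subtype.forall)

theorem Covariant.forces_invImage_iff (h : A.toStarSubalgebra ≃⋆ₐ[ℂ] A.toStarSubalgebra)
    (ψ : State A) (a : A.toStarSubalgebra) (Δ : Set ℝ) (C : Context A) :
    Forces C (elementary a Δ ≫ invImage h ≫ valuation ψ (image h)) (lowerOne A) ↔
      ∀ D ≥ C, ψ.localValuation (image h D) ((image h D).specOpen
        (D.projImage h (innerDas D.toVN (spectralProjection (a : H →L[ℂ] H) Δ)))) = 1 :=
  Subtype.ext_iff.trans (funext_iff.trans Subtype.forall)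

theorem Contravariant.forces_iff_forces_image
    (h : A.toStarSubalgebra ≃⋆ₐ[ℂ] A.toStarSubalgebra) (ψ : State A)
    {a : A.toStarSubalgebra} (ha : IsSelfAdjoint a) {Δ : Set ℝ} (hΔ : MeasurableSet Δ)
    (C : Context A) :
    Forces C (elementary a Δ ≫ invImage h ≫ valuation ψ (image h)) (lowerOne A) ↔
      Forces (image h C) (elementary (h a) Δ ≫ valuation ψ OrderHom.id) (lowerOne A) := by
  obtain ⟨p, hp, hhp⟩ := exists_proj_spectralProjection h ha hΔ
  rw [forces_invImage_iff, forces_elementary_iff, hp, hhp]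
  simp only [map_outerDas]
  constructor
  · intro H E hE
    have hD := (image h.symm).monotone hE
    rw [image_symm_image] at hD
    have := H _ hD
    rwa [image_image_symm] at this
  · exact fun H D hD => H _ ((image h).monotone hD)

theorem Covariant.forces_iff_forces_image
    (h : A.toStarSubalgebra ≃⋆ₐ[ℂ] A.toStarSubalgebra) (ψ : State A)
    {a : A.toStarSubalgebra} (ha : IsSelfAdjoint a) {Δ : Set ℝ} (hΔ : MeasurableSet Δ)
    (C : Context A) :
    Forces C (elementary a Δ ≫ invImage h ≫ valuation ψ (image h)) (lowerOne A) ↔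
      Forces (image h C) (elementary (h a) Δ ≫ valuation ψ OrderHom.id) (lowerOne A) := by
  obtain ⟨p, hp, hhp⟩ := exists_proj_spectralProjection h ha hΔ
  rw [forces_invImage_iff, forces_elementary_iff, hp, hhp]
  simp only [map_innerDas]
  constructor
  · intro H E hE
    have hD := (image h.symm).monotone hE
    rw [image_symm_image] at hD
    have := H _ hD
    rwa [image_image_symm] at this
  · exact fun H D hD => H _ ((image h).monotone hD)

/-- Surjectivity of `image h` turns the equivalence at each context into an equality of sieves or
cosieves. -/
theorem Context.image_image_eq (h : A.toStarSubalgebra ≃⋆ₐ[ℂ] A.toStarSubalgebra)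
    {S T : Set (Context A)} (hST : ∀ C, C ∈ S ↔ image h C ∈ T) : image h '' S = T := by
  ext E
  constructor
  · rintro ⟨C, hC, rfl⟩
    exact (hST C).mp hC
  · intro hE
    refine ⟨image h.symm E, (hST _).mpr ?_, image_image_symm h E⟩
    rwa [image_image_symm]

end Daseinisation

theorem theorem5p18 {H : Type u} [NormedAddCommGroup H] [InnerProductSpace ℂ H] [CompleteSpace H]
    (A : VonNeumannAlgebra H) (h : A.toStarSubalgebra ≃⋆ₐ[ℂ] A.toStarSubalgebra) (ψ : State A)
    (a : A.toStarSubalgebra) (ha : IsSelfAdjoint a) (Δ : Set ℝ) (hΔ : MeasurableSet Δ) :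
    -- the context `ĥ(C)` is the set `h[C]`
    (∀ C : Context A, ((Context.image h C).toVN : Set (H →L[ℂ] H)) = C.imageSet h) ∧
    -- contravariant model
    (∀ C : Context A,
      Contravariant.Forces C
        (Contravariant.elementary a Δ ≫ Contravariant.invImage h ≫
          Contravariant.valuation ψ (Context.image h)) (Contravariant.lowerOne A) ↔
      Contravariant.Forces (Context.image h C)
        (Contravariant.elementary (h a) Δ ≫ Contravariant.valuation ψ OrderHom.id)
        (Contravariant.lowerOne A)) ∧
    (Context.image h '' (Contravariant.truthValue
        (Contravariant.elementary a Δ ≫ Contravariant.invImage h ≫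
          Contravariant.valuation ψ (Context.image h)) (Contravariant.lowerOne A) :
            Set (Context A)) =
      (Contravariant.truthValue
        (Contravariant.elementary (h a) Δ ≫ Contravariant.valuation ψ OrderHom.id)
        (Contravariant.lowerOne A) : Set (Context A))) ∧
    -- covariant model
    (∀ C : Context A,
      Covariant.Forces C
        (Covariant.elementary a Δ ≫ Covariant.invImage h ≫
          Covariant.valuation ψ (Context.image h)) (Covariant.lowerOne A) ↔
      Covariant.Forces (Context.image h C)
        (Covariant.elementary (h a) Δ ≫ Covariant.valuation ψ OrderHom.id)
        (Covariant.lowerOne A)) ∧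
    (Context.image h '' (Covariant.truthValue
        (Covariant.elementary a Δ ≫ Covariant.invImage h ≫
          Covariant.valuation ψ (Context.image h)) (Covariant.lowerOne A) :
            Set (Context A)) =
      (Covariant.truthValue
        (Covariant.elementary (h a) Δ ≫ Covariant.valuation ψ OrderHom.id)
        (Covariant.lowerOne A) : Set (Context A))) := by
  have h₁ := Contravariant.forces_iff_forces_image h ψ ha hΔ
  have h₂ := Covariant.forces_iff_forces_image h ψ ha hΔ
  exact ⟨Context.coe_image_eq_imageSet h, h₁, Context.image_image_eq h h₁, h₂,
    Context.image_image_eq h h₂⟩
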